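/- Let $\alpha\in[0,1)$, $T>0$, let $k\ge 4$ be an integer, and let $f_0\in H^k(\mathbb R^2)$ be real-valued, where $\|g\|_{H^k}^2=\|g\|_{L^2}^2+\|(-\Delta)^{k/2}g\|_{L^2}^2$. A solution on $[0,T]$ with initial datum $f_0$ of the generalised $\alpha$-Muskat contour equation is a real-valued $f\in C^1([0,T];H^k(\mathbb R^2))$, each $f(\cdot,t)$ being identified with its continuous representative, such that $f(\cdot,0)=f_0$ and, for all $x\in\mathbb R^2$ and $t\in[0,T]$, $$\partial_t f(x,t)=\mathrm{PV}\int_{\mathbb R^2}\frac{\bigl(\nabla f(x,t)-\nabla f(x-y,t)\bigr)\cdot y}{\bigl[|y|^2+(f(x,t)-f(x-y,t))^2\bigr]^{\frac{3+\alpha}{2}}}\,dy ,$$ where $\mathrm{PV}\int_{\mathbb R^2}$ is the limit of $\int_{\delta<|y|<R}$ as $\delta\to0^+$, $R\to\infty$ (and $\partial_t$ is one-sided at the endpoints of $[0,T]$). The norms $\|\nabla f(t)\|_{L^p}$ are the $L^p(\mathbb R^2)$ norms of the Euclidean length $|\nabla f(\cdot,t)|$. Theorem. There is a function $C_\#=C_\#(a,b,M,\varepsilon,\alpha)$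 with positive values such that the following holds for all $\alpha\in[0,1)$, $\varepsilon\in(0,1+\alpha)$, $T>0$, $M_T>0$, $k\ge4$ and $f_0\in H^k(\mathbb R^2)$. If $f$ is the solution on $[0,T]$ with initial datum $f_0$, if $$\|\nabla f_0\|_{L^\infty}<\sqrt{\frac{1+\alpha-\varepsilon}{5+\alpha+\varepsilon}},$$ and if $\sup_{t\in[0,T]}\|\nabla f(t)\|_{L^1}\le M_T$, then for all $t\in[0,T]$ $$\|\nabla f(t)\|_{L^\infty}\le\frac{\|\nabla f_0\|_{L^\infty}}{\bigl[1+C_\#\bigl(\|f_0\|_{L^\infty},\|\nabla f_0\|_{L^\infty},M_T,\varepsilon,\alpha\bigr)\,t\bigr]^{\frac{2}{1+\alpha}}}.$$ -/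

import Mathlib

open MeasureTheory Filter Set
open scoped Topology ENNReal FourierTransform Gradient

noncomputable section

namespace AlphaMuskat

/-- The Euclidean plane. -/
abbrev Plane : Type := EuclideanSpace ℝ (Fin 2)

/-! ### The Sobolev spaces `H^k` and curves of class `C^1` in them -/

open Classical in
/-- The (Plancherel) Fourier transform of a real function in `L²` of the plane; the value is `0` for
functions that are not in `L²`. The convention is `f̂(ξ) = ∫ exp(-2πi x·ξ) f(x) dx`. -/
def fourierL2 (f : Plane → ℝ) : Plane → ℂ :=
  if h : MemLp (fun x => (f x : ℂ)) 2 volume then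
    ((𝓕 (h.toLp (fun x => (f x : ℂ))) : Lp ℂ 2 (volume : Measure Plane)) : Plane → ℂ)
  else 0

/-- The norm `‖f‖_{H^k} = (‖f‖²_{L²} + ‖Λ^k f‖²_{L²})^{1/2}` with `Λ = (-Δ)^{1/2}`, of a function
`f` in `L²`, written on the Fourier side, where `Λ` has the symbol `2π|ξ|`. It may be infinite. -/
def sobolevNorm (k : ℕ) (f : Plane → ℝ) : ℝ≥0∞ :=
  (∫⁻ ξ, ENNReal.ofReal (1 + (2 * Real.pi * ‖ξ‖) ^ (2 * k)) * ‖fourierL2 f ξ‖ₑ ^ 2) ^ (1 / 2 : ℝ)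

/-- Membership in `H^k` of the plane. -/
def MemH (k : ℕ) (f : Plane → ℝ) : Prop :=
  MemLp f 2 volume ∧ sobolevNorm k f < ∞

/-- `f ∈ C^1([0,T]; H^k)`: there is a continuous curve `f'` in `H^k` which is the derivative of the
curve `f` for the norm of `H^k`, one-sided at the endpoints. -/
def IsC1Curve (k : ℕ) (T : ℝ) (f : ℝ → Plane → ℝ) : Prop :=
  (∀ t ∈ Icc 0 T, MemH k (f t)) ∧
  ∃ f' : ℝ → Plane → ℝ,
    (∀ t ∈ Icc 0 T, MemH k (f' t)) ∧
    (∀ t ∈ Icc 0 T,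
      Tendsto (fun s => sobolevNorm k (fun x => (s - t)⁻¹ * (f s x - f t x) - f' t x))
        (𝓝[Icc 0 T \ {t}] t) (𝓝 0)) ∧
    (∀ t ∈ Icc 0 T,
      Tendsto (fun s => sobolevNorm k (fun x => f' s x - f' t x)) (𝓝[Icc 0 T] t) (𝓝 0))

/-! ### The contour equation -/

/-- The principal value of `∫ F(y) dy` over the plane, with singular points `0` and `∞`, exists and
equals `v`: it is the limit of the integrals over `δ < |y| < R` as `δ → 0⁺` and `R → ∞`. -/
def HasPrincipalValue (F : Plane → ℝ) (v : ℝ) : Prop :=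
  (∀ δ R : ℝ, 0 < δ → IntegrableOn F {y | δ < ‖y‖ ∧ ‖y‖ < R} volume) ∧
  Tendsto (fun p : ℝ × ℝ => ∫ y in {y : Plane | p.1 < ‖y‖ ∧ ‖y‖ < p.2}, F y)
    (𝓝[>] (0 : ℝ) ×ˢ atTop) (𝓝 v)

/-- The integrand
`(∇g(x) - ∇g(x-y))·y / [|y|² + (g(x) - g(x-y))²]^{(3+α)/2}` of the contour equation. -/
def contourIntegrand (α : ℝ) (g : Plane → ℝ) (x y : Plane) : ℝ :=
  inner ℝ (∇ g x - ∇ g (x - y)) y /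
    (‖y‖ ^ 2 + (g x - g (x - y)) ^ 2) ^ ((3 + α) / 2)

/-- `f` is a solution in `C^1([0,T]; H^k)` of the contour equation of the generalised Muskat problem
(with `(ρ₂ - ρ₁)/(4π) = 1`) with initial interface `f₀`. The value `f t` is the continuous
representative of its class, so that the equation makes sense at every point. -/
structure IsSolution (k : ℕ) (α T : ℝ) (f₀ : Plane → ℝ) (f : ℝ → Plane → ℝ) : Prop where
  isC1Curve : IsC1Curve k T f
  continuous : ∀ t ∈ Icc 0 T, Continuous (f t)
  equation : ∀ t ∈ Icc 0 T, ∀ x : Plane, ∃ v : ℝ,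
    HasPrincipalValue (contourIntegrand α (f t) x) v ∧
    HasDerivWithinAt (fun s => f s x) v (Icc 0 T) t
  initial : f 0 = f₀

end AlphaMuskat

end

/-! The gradient is controlled through finite differences, so the equation is never differentiated.
Fix a shift `w ≠ 0` and let `D(z) = f(z + w) - f(z)` have a positive maximum at `x`. The gradients
at `x` and `x + w` then agree. In polar coordinates about the two points, an exact radial derivative
is split off the integrands (`radialBoundary`). What is left along a ray depends only on the slope
`q` of the chord from the base point, through `(a - q)(1 + q²)^{-(3+α)/2} - α Φ(q)`, where `a` is
the common directional derivative. Below the slope threshold this function decreases at rate at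
least `ε/8` (`kernel_decreasing`). Since maximality orders the chord slopes at the two points, the
velocity difference at the maximum is at most `-(ε/8) ∫ |y|^{-3-α} (D(x) - D(x - y)) dy`.

The `L¹` norm of `D` is at most `|w| M`, so `D` cannot stay close to its maximum on a large disc.
This bounds the dissipation below by a multiple of `|w| (D(x)/|w|)^{(3+α)/2}`
(`velocity_difference_le`). Comparison with the solution of `B' = -c B^{(3+α)/2}` gives `D ≤ |w|
B(t)` for all `w`, hence `|∇f| ≤ B(t)`. A continuity argument in time shows that the slope never
reaches the threshold (`norm_fderiv_le_threshold`).

The regularity required is `C^{1,1}`, decay at infinity and Lipschitz dependence on time in `C¹`;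
these follow from the embedding of `H^k`. -/

namespace AlphaMuskat

/-! ### Fourier inversion and regularity of Fourier integrals -/

section Fourier

variable {E : Type*} [NormedAddCommGroup E] [InnerProductSpace ℝ E] [FiniteDimensional ℝ E]
  [MeasurableSpace E] [BorelSpace E]

/-- A function of `L²` whose Fourier transform is integrable is almost everywhere the inverse
Fourier integral of its Fourier transform. -/
theorem ae_eq_fourierInv_of_integrable_fourier (f : Lp ℂ 2 (volume : Measure E))
    (hF : Integrable ((𝓕 f : Lp ℂ 2 (volume : Measure E)) : E → ℂ)) :
    (f : E → ℂ) =ᵐ[volume] 𝓕⁻ ((𝓕 f : Lp ℂ 2 (volume : Measure E)) : E → ℂ) := by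
  set F : E → ℂ := ((𝓕 f : Lp ℂ 2 (volume : Measure E)) : E → ℂ) with hFdef
  have hcont : Continuous (𝓕⁻ F) := by
    rw [Real.fourierInv_eq_fourier_comp_neg]
    exact VectorFourier.fourierIntegral_continuous Real.continuous_fourierChar
      (by exact continuous_inner) hF.comp_neg
  refine ae_eq_of_integral_contDiff_smul_eq
    ((Lp.memLp f).locallyIntegrable (by norm_num)) hcont.locallyIntegrable ?_
  intro g hg hgs
  have hgs' : HasCompactSupport (fun x => (g x : ℂ)) :=
    hgs.comp_left (g := fun r : ℝ => (r : ℂ)) (by simp)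
  have hg' : ContDiff ℝ ((⊤ : ℕ∞) : WithTop ℕ∞) (fun x => (g x : ℂ)) :=
    Complex.ofRealCLM.contDiff.comp hg
  set φ : SchwartzMap E ℂ := hgs'.toSchwartzMap hg' with hφ
  have hφx : ∀ x, φ x = (g x : ℂ) := fun x => rfl
  -- Inversion is moved to tempered distributions, where it holds by duality and is compatible with
  -- the `L²` transform.
  have key : (f : TemperedDistribution E ℂ) φ
      = ((𝓕 f : Lp ℂ 2 (volume : Measure E)) : TemperedDistribution E ℂ) (𝓕⁻ φ) := by
    rw [← TemperedDistribution.fourierInv_apply, Lp.fourierInv_toTemperedDistribution_eq,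
      FourierTransform.fourierInv_fourier_eq]
  rw [Lp.toTemperedDistribution_apply, Lp.toTemperedDistribution_apply] at key
  have h1 : ∀ x, g x • f x = φ x • f x := fun x => by rw [hφx]; simp
  have h2 : ∀ x, g x • (𝓕⁻ F) x = φ x • (𝓕⁻ F) x := fun x => by rw [hφx]; simp
  simp_rw [h1, h2]
  rw [key, SchwartzMap.fourierInv_coe]
  -- Fubini moves the transform from the test function to `F`; the reflection `F (-x)` turns the
  -- inverse transform into a forward one.
  have hflip := VectorFourier.integral_bilin_fourierIntegral_eq_flip (ContinuousLinearMap.mul ℂ ℂ)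
    (L := innerₗ E) (μ := volume) (ν := volume) (f := (φ : E → ℂ)) (g := fun x => F (-x))
    Real.continuous_fourierChar continuous_inner φ.integrable hF.comp_neg
  have e1 : ∀ x, (𝓕⁻ (φ : E → ℂ)) x • F x = (fun y => (𝓕 (φ : E → ℂ)) y * F (-y)) (-x) := by
    intro x
    simp [Real.fourierInv_eq_fourier_neg]
  refine (integral_congr_ae (ae_of_all _ e1)).trans
    ((integral_neg_eq_self (fun y => (𝓕 (φ : E → ℂ)) y * F (-y)) volume).trans ?_)
  rw [Real.fourierInv_eq_fourier_comp_neg]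
  simpa using! hflip

theorem norm_fourier_le_of_norm_le {W : Type*} [NormedAddCommGroup W] [NormedSpace ℂ W]
    {u : E → W} {b : E → ℝ} (hb : Integrable b) (hu : ∀ ξ, ‖u ξ‖ ≤ b ξ) (x : E) :
    ‖𝓕 u x‖ ≤ ∫ ξ, b ξ :=
  (VectorFourier.norm_fourierIntegral_le_integral_norm _ _ _ _ _).trans
    (integral_mono_of_nonneg (ae_of_all _ fun _ => norm_nonneg _) hb (ae_of_all _ hu))

/-- The real part of a Fourier integral with two integrable moments is differentiable, with
quantitative bounds, and it vanishes at infinity. -/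
theorem re_fourier_regularity {F : E → ℂ} (hm : AEStronglyMeasurable F volume)
    (hF : Integrable (fun ξ => (1 + ‖ξ‖ ^ 2) * ‖F ξ‖)) :
    let G : E → ℝ := fun x => (𝓕 F x).re
    let N := (2 * Real.pi) ^ 2 * ∫ ξ, (1 + ‖ξ‖ ^ 2) * ‖F ξ‖
    Differentiable ℝ G ∧ (∀ x, |G x| ≤ N) ∧ (∀ x, ‖fderiv ℝ G x‖ ≤ N) ∧
      (∀ x y, ‖fderiv ℝ G x - fderiv ℝ G y‖ ≤ N * ‖x - y‖) ∧ Tendsto G (cocompact E) (𝓝 0) := by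
  intro G N
  have hpi : 1 ≤ 2 * Real.pi := by linarith [Real.pi_gt_three]
  have i0 : Integrable F := hF.mono' hm (ae_of_all _ fun ξ => by
    nlinarith [norm_nonneg (F ξ), sq_nonneg ‖ξ‖, mul_nonneg (sq_nonneg ‖ξ‖) (norm_nonneg (F ξ))])
  have i1 : Integrable (fun ξ => ‖ξ‖ * ‖F ξ‖) :=
    hF.mono' (continuous_norm.aestronglyMeasurable.mul hm.norm) (ae_of_all _ fun ξ => by
      rw [Real.norm_of_nonneg (by positivity)]
      gcongr
      nlinarith [sq_nonneg (‖ξ‖ - 1)])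
  have i2 : Integrable (fun ξ => ‖ξ‖ * ‖VectorFourier.fourierSMulRight (innerSL ℝ) F ξ‖) := by
    refine (hF.const_mul (2 * Real.pi)).mono' (continuous_norm.aestronglyMeasurable.mul
      hm.fourierSMulRight.norm) (ae_of_all _ fun ξ => ?_)
    rw [Real.norm_of_nonneg (by positivity), VectorFourier.norm_fourierSMulRight,
      innerSL_apply_norm]
    nlinarith [norm_nonneg (F ξ), mul_nonneg Real.pi_pos.le (norm_nonneg (F ξ))]
  set F1 := VectorFourier.fourierSMulRight (innerSL ℝ) F with hF1
  have i1' : Integrable F1 := by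
    refine (i1.const_mul (2 * Real.pi)).mono' hm.fourierSMulRight (ae_of_all _ fun ξ => ?_)
    rw [hF1, VectorFourier.norm_fourierSMulRight, innerSL_apply_norm]
    exact (mul_assoc _ _ _).le
  have d0 := Real.hasFDerivAt_fourier i0 i1
  have d1 := Real.hasFDerivAt_fourier i1' i2
  have dG : ∀ x, HasFDerivAt G (Complex.reCLM ∘L (𝓕 F1 x)) x := fun x =>
    (Complex.reCLM.hasFDerivAt (x := 𝓕 F x)).comp x (d0 x)
  have hb := hF.const_mul ((2 * Real.pi) ^ 2)
  have hNi : ∫ ξ, (2 * Real.pi) ^ 2 * ((1 + ‖ξ‖ ^ 2) * ‖F ξ‖) = N := integral_const_mul _ _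
  have hπ : 1 ≤ (2 * Real.pi) ^ 2 := by nlinarith
  have hre : ∀ L : E →L[ℝ] ℂ, ‖Complex.reCLM ∘L L‖ ≤ ‖L‖ := fun L =>
    (Complex.reCLM.opNorm_comp_le L).trans (by simp)
  have b0 : ∀ x, ‖𝓕 F x‖ ≤ N := fun x => hNi ▸ norm_fourier_le_of_norm_le hb (fun ξ => by
    have := mul_nonneg (sq_nonneg ‖ξ‖) (norm_nonneg (F ξ))
    nlinarith [norm_nonneg (F ξ)]) x
  have b1 : ∀ x, ‖𝓕 F1 x‖ ≤ N := fun x => hNi ▸ norm_fourier_le_of_norm_le hb (fun ξ => by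
    rw [hF1, VectorFourier.norm_fourierSMulRight, innerSL_apply_norm, mul_assoc]
    have : ‖ξ‖ ≤ 1 + ‖ξ‖ ^ 2 := by nlinarith [sq_nonneg (‖ξ‖ - 1)]
    gcongr
    nlinarith) x
  have b2 : ∀ x, ‖𝓕 (VectorFourier.fourierSMulRight (innerSL ℝ) F1) x‖ ≤ N := fun x =>
    hNi ▸ norm_fourier_le_of_norm_le hb (fun ξ => by
    rw [VectorFourier.norm_fourierSMulRight, hF1, VectorFourier.norm_fourierSMulRight,
      innerSL_apply_norm]
    have := mul_nonneg (sq_nonneg Real.pi) (norm_nonneg (F ξ))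
    nlinarith) x
  refine ⟨fun x => (dG x).differentiableAt, fun x => (Complex.abs_re_le_norm _).trans (b0 x),
    fun x => (dG x).fderiv ▸ (hre _).trans (b1 x), fun x y => ?_, ?_⟩
  · rw [(dG x).fderiv, (dG y).fderiv, ← ContinuousLinearMap.comp_sub]
    refine (hre _).trans ?_
    exact convex_univ.norm_image_sub_le_of_norm_hasFDerivWithin_le
      (fun z _ => (d1 z).hasFDerivWithinAt) (fun z _ => b2 z) (mem_univ y) (mem_univ x)
  -- The Riemann–Lebesgue lemma.
  · have := (Complex.continuous_re.tendsto 0).comp (tendsto_integral_exp_inner_smul_cocompact F)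
    rwa [Complex.zero_re] at this

end Fourier

/-! ### Embedding of `H^k` -/

/-- For `r ≤ 1` one has `(1 + r²)⁴ ≤ 2⁴`, and for `r ≥ 1` it is at most `2⁴ r⁸ ≤ 16 (2πr)^{2k}`. The
resulting weight is integrable in the plane. -/
theorem sq_one_add_sq_div_le {k : ℕ} (hk : 4 ≤ k) {r : ℝ} (hr : 0 ≤ r) :
    (1 + r ^ 2) ^ 2 / (1 + (2 * Real.pi * r) ^ (2 * k)) ≤ 16 * (1 + r ^ 2) ^ (-(4 : ℝ) / 2) := by
  have e : (1 + r ^ 2) ^ (-(4 : ℝ) / 2) = ((1 + r ^ 2) ^ 2)⁻¹ := by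
    rw [show -(4 : ℝ) / 2 = -((2 : ℕ) : ℝ) by norm_num, Real.rpow_neg (by positivity),
      Real.rpow_natCast]
  have hpi : 1 ≤ 2 * Real.pi := by linarith [Real.pi_gt_three]
  have hp : 0 ≤ (2 * Real.pi * r) ^ (2 * k) := by positivity
  rw [e, ← div_eq_mul_inv, div_le_div_iff₀ (by positivity) (by positivity)]
  have h1 : (1 + r ^ 2) ^ 2 * (1 + r ^ 2) ^ 2 = (1 + r ^ 2) ^ 4 := by ring
  rw [h1]
  rcases le_total r 1 with h | h
  · have : (1 + r ^ 2) ^ 4 ≤ (2 : ℝ) ^ 4 := by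
      gcongr
      nlinarith
    linarith
  · have h2 : (1 + r ^ 2) ^ 4 ≤ (2 * r ^ 2) ^ 4 := by
      gcongr
      nlinarith
    have h3 : r ^ 8 ≤ (2 * Real.pi * r) ^ (2 * k) :=
      (pow_le_pow_right₀ h (by lia)).trans
        (pow_le_pow_left₀ hr (by nlinarith) _)
    nlinarith

/-- The integral of the weight `16 (1 + |ξ|²)⁻²` in the embedding of `H^4` into `C²`. -/
noncomputable def embeddingConst : ℝ≥0∞ :=
  (∫⁻ ξ : Plane, ENNReal.ofReal (16 * (1 + ‖ξ‖ ^ 2) ^ (-(4 : ℝ) / 2))) ^ (1 / 2 : ℝ)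

theorem embeddingConst_lt_top : embeddingConst < ∞ := by
  have h : Integrable (fun ξ : Plane => 16 * (1 + ‖ξ‖ ^ 2) ^ (-(4 : ℝ) / 2)) :=
    (integrable_rpow_neg_one_add_norm_sq (by simp; norm_num)).const_mul 16
  exact ENNReal.rpow_lt_top_of_nonneg (by norm_num) h.lintegral_lt_top.ne

/-- Cauchy–Schwarz, with the Sobolev weight split as `√w · (1/√w)`. -/
theorem lintegral_weight_mul_fourierL2_le {k : ℕ} (hk : 4 ≤ k) (g : Plane → ℝ)
    (hm : AEStronglyMeasurable (fourierL2 g) volume) :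
    ∫⁻ ξ, ENNReal.ofReal (1 + ‖ξ‖ ^ 2) * ‖fourierL2 g ξ‖ₑ ≤ embeddingConst * sobolevNorm k g := by
  set w : Plane → ℝ := fun ξ => 1 + (2 * Real.pi * ‖ξ‖) ^ (2 * k) with hw
  have hwpos : ∀ ξ, 0 < w ξ := fun ξ => by
    have : 0 ≤ (2 * Real.pi * ‖ξ‖) ^ (2 * k) := by positivity
    simp only [hw]; linarith
  have hwc : Continuous w := by fun_prop
  have H := ENNReal.lintegral_mul_le_Lp_mul_Lq (volume : Measure Plane) Real.HolderConjugate.two_two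
    (f := fun ξ => ENNReal.ofReal ((1 + ‖ξ‖ ^ 2) / √(w ξ)))
    (g := fun ξ => ENNReal.ofReal (√(w ξ)) * ‖fourierL2 g ξ‖ₑ)
    (by fun_prop) ((by fun_prop : AEMeasurable _ _).mul hm.enorm)
  have e0 : ∀ ξ, ENNReal.ofReal (1 + ‖ξ‖ ^ 2) * ‖fourierL2 g ξ‖ₑ
      = ENNReal.ofReal ((1 + ‖ξ‖ ^ 2) / √(w ξ)) * (ENNReal.ofReal (√(w ξ)) * ‖fourierL2 g ξ‖ₑ) := by
    intro ξ
    have := Real.sqrt_pos.2 (hwpos ξ)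
    rw [← mul_assoc, ← ENNReal.ofReal_mul (by positivity), div_mul_cancel₀ _ this.ne']
  rw [lintegral_congr e0]
  refine H.trans ?_
  unfold embeddingConst sobolevNorm
  gcongr with ξ ξ
  · rw [ENNReal.ofReal_rpow_of_nonneg (by positivity) (by norm_num)]
    apply ENNReal.ofReal_le_ofReal
    rw [Real.rpow_two, div_pow, Real.sq_sqrt (hwpos ξ).le]
    exact sq_one_add_sq_div_le hk (norm_nonneg ξ)
  · rw [ENNReal.rpow_two, mul_pow, ← ENNReal.ofReal_pow (by positivity), Real.sq_sqrt (hwpos ξ).le]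

/-- Bounds for a function and its derivative, together with decay at infinity. -/
structure C11Bound (G : Plane → ℝ) (N : ℝ) : Prop where
  differentiable : Differentiable ℝ G
  abs_le : ∀ x, |G x| ≤ N
  norm_fderiv_le : ∀ x, ‖fderiv ℝ G x‖ ≤ N
  norm_fderiv_sub_le : ∀ x y, ‖fderiv ℝ G x - fderiv ℝ G y‖ ≤ N * ‖x - y‖
  tendsto_zero : Tendsto G (cocompact Plane) (𝓝 0)

/-- Every function of `H^k` with `k ≥ 4` has a representative in `C^{1,1}` vanishing at infinity. -/
theorem MemH.exists_C11Bound {k : ℕ} (hk : 4 ≤ k) {g : Plane → ℝ} (hg : MemH k g) :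
    ∃ G : Plane → ℝ, g =ᵐ[volume] G ∧
      C11Bound G ((2 * Real.pi) ^ 2 * (embeddingConst * sobolevNorm k g).toReal) := by
  have hg2 : MemLp (fun x => (g x : ℂ)) 2 volume := hg.1.ofReal
  set Fl : Lp ℂ 2 (volume : Measure Plane) := 𝓕 (hg2.toLp (fun x => (g x : ℂ))) with hFl
  have hF : fourierL2 g = (Fl : Plane → ℂ) := by simp only [fourierL2, hg2, dif_pos, hFl]
  have hm : AEStronglyMeasurable (Fl : Plane → ℂ) volume := Lp.aestronglyMeasurable _
  have hle := lintegral_weight_mul_fourierL2_le hk g (hF ▸ hm)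
  have htop : embeddingConst * sobolevNorm k g < ∞ := ENNReal.mul_lt_top embeddingConst_lt_top hg.2
  rw [hF] at hle
  have hen : ∀ ξ, ENNReal.ofReal ((1 + ‖ξ‖ ^ 2) * ‖Fl ξ‖)
      = ENNReal.ofReal (1 + ‖ξ‖ ^ 2) * ‖Fl ξ‖ₑ := fun ξ => by
    rw [ENNReal.ofReal_mul (by positivity), ofReal_norm]
  have hmw : AEStronglyMeasurable (fun ξ => (1 + ‖ξ‖ ^ 2) * ‖Fl ξ‖) volume :=
    (by fun_prop : Continuous fun ξ : Plane => 1 + ‖ξ‖ ^ 2).aestronglyMeasurable.mul hm.norm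
  have hint : Integrable (fun ξ => (1 + ‖ξ‖ ^ 2) * ‖Fl ξ‖) := by
    refine ⟨hmw, ?_⟩
    rw [hasFiniteIntegral_iff_ofReal (ae_of_all _ fun ξ => by positivity), lintegral_congr hen]
    exact hle.trans_lt htop
  have hFi : Integrable (Fl : Plane → ℂ) := hint.mono' hm (ae_of_all _ fun ξ => by
    nlinarith [mul_nonneg (sq_nonneg ‖ξ‖) (norm_nonneg (Fl ξ))])
  have hneg : Integrable (fun ξ => (1 + ‖ξ‖ ^ 2) * ‖Fl (-ξ)‖) := by
    simpa using hint.comp_neg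
  have reg := re_fourier_regularity (F := fun ξ => Fl (-ξ)) hFi.comp_neg.1 hneg
  have hval : ∫ ξ, (1 + ‖ξ‖ ^ 2) * ‖Fl (-ξ)‖ ≤ (embeddingConst * sobolevNorm k g).toReal := by
    have e := integral_neg_eq_self (fun ξ : Plane => (1 + ‖ξ‖ ^ 2) * ‖Fl ξ‖) volume
    simp only [norm_neg] at e
    rw [e, integral_eq_lintegral_of_nonneg_ae (ae_of_all _ fun ξ => by positivity) hmw,
      lintegral_congr hen]
    exact ENNReal.toReal_mono htop.ne hle
  have hN : (2 * Real.pi) ^ 2 * ∫ ξ, (1 + ‖ξ‖ ^ 2) * ‖Fl (-ξ)‖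
      ≤ (2 * Real.pi) ^ 2 * (embeddingConst * sobolevNorm k g).toReal := by gcongr
  obtain ⟨r1, r2, r3, r4, r5⟩ := reg
  refine ⟨_, ?_, r1, fun x => (r2 x).trans hN, fun x => (r3 x).trans hN,
    fun x y => (r4 x y).trans (by gcongr), r5⟩
  have hae := ae_eq_fourierInv_of_integrable_fourier (hg2.toLp (fun x => (g x : ℂ))) hFi
  filter_upwards [hae, hg2.coeFn_toLp] with x hx hx'
  rw [← Real.fourierInv_eq_fourier_comp_neg, ← hx, hx', Complex.ofReal_re]

theorem MemH.c11Bound {k : ℕ} (hk : 4 ≤ k) {g : Plane → ℝ} (hg : MemH k g) (hc : Continuous g) :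
    C11Bound g ((2 * Real.pi) ^ 2 * (embeddingConst * sobolevNorm k g).toReal) := by
  obtain ⟨G, h, hG⟩ := hg.exists_C11Bound hk
  obtain rfl := (hc.ae_eq_iff_eq volume hG.differentiable.continuous).1 h
  exact hG

theorem sobolevNorm_congr_ae {k : ℕ} {g h : Plane → ℝ} (hgh : g =ᵐ[volume] h) :
    sobolevNorm k g = sobolevNorm k h := by
  have e : (fun x => (g x : ℂ)) =ᵐ[volume] fun x => (h x : ℂ) := by
    filter_upwards [hgh] with x hx
    rw [hx]
  have : fourierL2 g = fourierL2 h := by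
    unfold fourierL2
    by_cases hg : MemLp (fun x => (g x : ℂ)) 2 volume
    · have hh := (memLp_congr_ae e).1 hg
      rw [dif_pos hg, dif_pos hh, (MemLp.toLp_eq_toLp_iff hg hh).2 e]
    · rw [dif_neg hg, dif_neg fun hh => hg ((memLp_congr_ae e).2 hh)]
  simp only [sobolevNorm, this]

/-- Near `t` the difference quotient is within Sobolev distance `1` of the derivative, and the
embedding makes this uniform in space for values and gradients. It serves to make the spatial
suprema continuous in time. -/
theorem IsC1Curve.exists_lipschitz_bound {k : ℕ} (hk : 4 ≤ k) {T : ℝ} {f : ℝ → Plane → ℝ}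
    (hf : IsC1Curve k T f) (hc : ∀ t ∈ Icc 0 T, Continuous (f t)) {t : ℝ} (ht : t ∈ Icc 0 T) :
    ∃ K, 0 ≤ K ∧ ∀ᶠ s in 𝓝[Icc 0 T] t, ∀ x, |f s x - f t x| ≤ K * |s - t| ∧
      ‖fderiv ℝ (f s) x - fderiv ℝ (f t) x‖ ≤ K * |s - t| := by
  obtain ⟨hH, f', hf', hlim, -⟩ := hf
  obtain ⟨G, hGae, hG⟩ := (hf' t ht).exists_C11Bound hk
  set N₂ := (2 * Real.pi) ^ 2 * (embeddingConst * sobolevNorm k (f' t)).toReal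
  set N₁ := (2 * Real.pi) ^ 2 * embeddingConst.toReal
  have hN₁ : 0 ≤ N₁ := by positivity
  have hN₂ : 0 ≤ N₂ := by positivity
  have ev := (tendsto_order.1 (hlim t ht)).2 1 zero_lt_one
  refine ⟨N₁ + N₂, by positivity, ?_⟩
  have hd : ∀ s ∈ Icc 0 T, Differentiable ℝ (f s) := fun s hs =>
    ((hH s hs).c11Bound hk (hc s hs)).differentiable
  rw [eventually_nhdsWithin_iff] at ev ⊢
  filter_upwards [ev] with s hev hs x
  rcases eq_or_ne s t with rfl | hst
  · simp
  have hlt := hev ⟨hs, hst⟩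
  have hsub : s - t ≠ 0 := sub_ne_zero.2 hst
  have hae : (fun x => (s - t)⁻¹ * (f s x - f t x) - f' t x) =ᵐ[volume]
      fun x => (s - t)⁻¹ * (f s x - f t x) - G x := by
    filter_upwards [hGae] with x hx
    rw [hx]
  have hmem : MemH k (fun x => (s - t)⁻¹ * (f s x - f t x) - G x) := by
    refine ⟨(memLp_congr_ae hae).1
      ((((hH s hs).1.sub (hH t ht).1).const_mul _).sub (hf' t ht).1), ?_⟩
    rw [← sobolevNorm_congr_ae hae]
    exact hlt.trans ENNReal.one_lt_top
  have hB := hmem.c11Bound hk (((continuous_const.mul ((hc s hs).sub (hc t ht)))).sub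
    hG.differentiable.continuous)
  have hle : (2 * Real.pi) ^ 2 * (embeddingConst * sobolevNorm k
      (fun x => (s - t)⁻¹ * (f s x - f t x) - G x)).toReal ≤ N₁ := by
    have : embeddingConst * sobolevNorm k (fun x => (s - t)⁻¹ * (f s x - f t x) - G x)
        ≤ embeddingConst := by
      rw [← sobolevNorm_congr_ae hae]
      exact mul_le_of_le_one_right' hlt.le
    exact mul_le_mul_of_nonneg_left (ENNReal.toReal_mono embeddingConst_lt_top.ne this)
      (by positivity)
  set h := fun x => (s - t)⁻¹ * (f s x - f t x) - G x with hh
  have e : ∀ y, f s y - f t y = (s - t) * (h y + G y) := fun y => by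
    simp only [hh]; field_simp; ring
  constructor
  · rw [e, abs_mul, mul_comm]
    gcongr
    exact (abs_add_le _ _).trans (add_le_add ((hB.abs_le x).trans hle) (hG.abs_le x))
  · have e' : fderiv ℝ (f s) x - fderiv ℝ (f t) x = (s - t) • (fderiv ℝ h x + fderiv ℝ G x) := by
      rw [← fderiv_sub (hd s hs x) (hd t ht x),
        ← fderiv_add (hB.differentiable x) (hG.differentiable x),
        ← fderiv_const_smul ((hB.differentiable x).add (hG.differentiable x))]
      congr 1
      ext y
      simpa using e y
    rw [e', norm_smul, Real.norm_eq_abs, mul_comm]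
    gcongr
    exact (norm_add_le _ _).trans
      (add_le_add ((hB.norm_fderiv_le x).trans hle) (hG.norm_fderiv_le x))

/-! ### The kernel in the slope variable -/

/-- The density `(1 + s²)^{-(3+α)/2}`. -/
noncomputable def slopeWeight (α s : ℝ) : ℝ := (1 + s ^ 2) ^ (-((3 + α) / 2))

/-- The primitive of `slopeWeight` vanishing at `0`. -/
noncomputable def slopePrimitive (α q : ℝ) : ℝ := ∫ s in (0 : ℝ)..q, slopeWeight α s

theorem continuous_slopeWeight (α : ℝ) : Continuous (slopeWeight α) :=
  (by fun_prop : Continuous fun s : ℝ => 1 + s ^ 2).rpow_const fun s => Or.inl (by positivity)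

theorem slopeWeight_pos (α s : ℝ) : 0 < slopeWeight α s := by
  unfold slopeWeight; positivity

theorem slopeWeight_le_one {α : ℝ} (hα : 0 ≤ α) (s : ℝ) : slopeWeight α s ≤ 1 :=
  Real.rpow_le_one_of_one_le_of_nonpos (by nlinarith [sq_nonneg s]) (by linarith)

theorem hasDerivAt_slopePrimitive (α q : ℝ) :
    HasDerivAt (slopePrimitive α) (slopeWeight α q) q :=
  intervalIntegral.integral_hasDerivAt_right ((continuous_slopeWeight α).intervalIntegrable _ _)
    ((continuous_slopeWeight α).stronglyMeasurableAtFilter _ _) (continuous_slopeWeight α).continuousAt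

theorem monotone_slopePrimitive (α : ℝ) : Monotone (slopePrimitive α) :=
  monotone_of_hasDerivAt_nonneg (hasDerivAt_slopePrimitive α) fun q => (slopeWeight_pos α q).le

theorem slopePrimitive_sub_le {α : ℝ} (hα : 0 ≤ α) {p q : ℝ} (hpq : p ≤ q) :
    slopePrimitive α q - slopePrimitive α p ≤ q - p := by
  have h : Monotone fun q => q - slopePrimitive α q :=
    monotone_of_hasDerivAt_nonneg (fun q => (hasDerivAt_id q).sub (hasDerivAt_slopePrimitive α q))
      fun q => sub_nonneg.2 (slopeWeight_le_one hα q)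
  have := h hpq
  simp only at this
  linarith

theorem hasDerivAt_slopeWeight (α q : ℝ) :
    HasDerivAt (slopeWeight α) (-(3 + α) * q * (1 + q ^ 2) ^ (-((5 + α) / 2))) q := by
  have h := ((hasDerivAt_pow 2 q).const_add 1).rpow_const (p := -((3 + α) / 2))
    (Or.inl (by positivity))
  refine h.congr_deriv ?_
  rw [show -((3 + α) / 2) - 1 = -((5 + α) / 2) by ring]
  push_cast
  ring

/-- The kernel `(a - q)(1 + q²)^{-(3+α)/2} - α Φ(q)` decreases in `q` at a definite rate as long as
the slopes are below the threshold. -/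
theorem kernel_decreasing {α ε m a : ℝ} (hα : α ∈ Ico (0 : ℝ) 1) (hε : 0 < ε)
    (hm : ε * (1 + m ^ 2) ≤ 1 + α - (5 + α) * m ^ 2) (ha : |a| ≤ m) {p q : ℝ} (hp : -m ≤ p)
    (hpq : p ≤ q) (hq : q ≤ m) :
    (a - q) * slopeWeight α q - α * slopePrimitive α q + ε / 8 * q
      ≤ (a - p) * slopeWeight α p - α * slopePrimitive α p + ε / 8 * p := by
  obtain ⟨hα0, hα1⟩ := hα
  have hder : ∀ s, HasDerivAt
      (fun q => (a - q) * slopeWeight α q - α * slopePrimitive α q + ε / 8 * q)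
      ((-1 * slopeWeight α s + (a - s) * (-(3 + α) * s * (1 + s ^ 2) ^ (-((5 + α) / 2))))
        - α * slopeWeight α s + ε / 8 * 1) s := fun s =>
    ((((hasDerivAt_id s).const_sub a).mul (hasDerivAt_slopeWeight α s)).sub
      ((hasDerivAt_slopePrimitive α s).const_mul α)).add ((hasDerivAt_id s).const_mul _)
  have hanti : AntitoneOn
      (fun q => (a - q) * slopeWeight α q - α * slopePrimitive α q + ε / 8 * q) (Icc (-m) m) := by
    refine antitoneOn_of_hasDerivWithinAt_nonpos (convex_Icc _ _)
      (fun s _ => (hder s).continuousAt.continuousWithinAt)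
      (fun s _ => (hder s).hasDerivWithinAt) fun s hs => ?_
    rw [interior_Icc] at hs
    have hm2 : m ^ 2 ≤ 1 := by nlinarith [sq_nonneg m]
    have hs2 : s ^ 2 ≤ m ^ 2 := sq_le_sq' hs.1.le hs.2.le
    have hm0 : 0 ≤ m := (abs_nonneg a).trans ha
    have has : -(a * s) ≤ m ^ 2 := by
      have : |a * s| ≤ m * m := by
        rw [abs_mul]
        exact mul_le_mul ha (abs_le.2 ⟨hs.1.le, hs.2.le⟩) (abs_nonneg _) hm0
      nlinarith [neg_abs_le (a * s)]
    set b := (1 + s ^ 2) ^ (-((5 + α) / 2)) with hb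
    have e : slopeWeight α s = b * (1 + s ^ 2) := by
      rw [slopeWeight, hb, ← Real.rpow_add_one (by positivity)]
      congr 1
      ring
    -- Here `1 + s² ≤ 2` and the exponent is at least `-3`; this is the origin of the factor `1/8`
    -- in all the rates.
    have hb8 : 1 / 8 ≤ b := by
      have h2 : (2 : ℝ) ^ (-(3 : ℝ)) ≤ b := calc
        (2 : ℝ) ^ (-(3 : ℝ)) ≤ (2 : ℝ) ^ (-((5 + α) / 2)) :=
          Real.rpow_le_rpow_of_exponent_le (by norm_num) (by linarith)
        _ ≤ b := Real.rpow_le_rpow_of_nonpos (by positivity) (by linarith) (by linarith)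
      refine le_trans (le_of_eq ?_) h2
      rw [Real.rpow_neg (by norm_num), show (3 : ℝ) = ((3 : ℕ) : ℝ) by norm_num, Real.rpow_natCast]
      norm_num
    rw [e]
    -- The two positive contributions are at most `2m²` and `(3 + α)m²`; their sum gives the
    -- coefficient `5 + α` in the threshold.
    have hbr : -(1 + α) + 2 * s ^ 2 - (3 + α) * (a * s) ≤ -ε := by nlinarith [sq_nonneg m]
    have : b * (-(1 + α) + 2 * s ^ 2 - (3 + α) * (a * s)) ≤ b * (-ε) :=
      mul_le_mul_of_nonneg_left hbr (by linarith)
    nlinarith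
  exact hanti ⟨hp, hpq.trans hq⟩ ⟨hp.trans hpq, hq⟩ hpq

/-! ### One direction -/

/-- Homogeneity of the kernel; the factor `r` in front is the Jacobian of polar coordinates. -/
theorem div_rpow_add_sq {α r u b : ℝ} (hr : 0 < r) :
    r * ((b * r) / (r ^ 2 + u ^ 2) ^ ((3 + α) / 2)) = r ^ (-1 - α) * (b * slopeWeight α (u / r)) := by
  have h1 : r ^ 2 + u ^ 2 = r ^ 2 * (1 + (u / r) ^ 2) := by field_simp
  have h2 : (r ^ 2 : ℝ) ^ ((3 + α) / 2) = r ^ (3 + α) := by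
    rw [← Real.rpow_natCast, ← Real.rpow_mul hr.le]
    congr 1
    push_cast
    ring
  have h3 : r ^ (-1 - α) = r ^ 2 * (r ^ (3 + α))⁻¹ := by
    rw [← Real.rpow_neg hr.le, ← Real.rpow_natCast r 2, ← Real.rpow_add hr]
    congr 1
    push_cast
    ring
  rw [h1, Real.mul_rpow (by positivity) (by positivity), h2, slopeWeight,
    Real.rpow_neg (by positivity), h3]
  field_simp

/-- The boundary term of the integration by parts along a ray. -/
noncomputable def radialBoundary (α : ℝ) (u : ℝ → ℝ) (r : ℝ) : ℝ :=
  -(r ^ (-α) * slopePrimitive α (u r / r))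

theorem hasDerivAt_radialBoundary {α r : ℝ} (hr : 0 < r) {u : ℝ → ℝ} {u' : ℝ}
    (hu : HasDerivAt u u' r) :
    HasDerivAt (radialBoundary α u)
      (r ^ (-1 - α) * (α * slopePrimitive α (u r / r) + (u r / r - u') * slopeWeight α (u r / r)))
      r := by
  have hq : HasDerivAt (fun r => u r / r) ((u' * r - u r * 1) / r ^ 2) r :=
    hu.div (hasDerivAt_id r) hr.ne'
  have h := ((Real.hasDerivAt_rpow_const (p := -α) (Or.inl hr.ne')).mul
    (HasDerivAt.comp (h := fun r => u r / r) r (hasDerivAt_slopePrimitive α (u r / r)) hq)).neg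
  refine h.congr_deriv ?_
  have e1 : r ^ (-α - 1) = r ^ (-1 - α) := by congr 1; ring
  have e2 : r ^ (-α) = r ^ (-1 - α) * r := by
    rw [← Real.rpow_add_one hr.ne']; congr 1; ring
  rw [e1, e2]
  simp only [Function.comp]
  field_simp
  ring

/-- Subtracting the derivative of `radialBoundary` eliminates `u'` and `W'`, whose order is unknown,
and leaves the decreasing kernel evaluated at `u/r ≤ W/r`. The boundary term at `R` has a favourable
sign; the one at `δ` is estimated using that `Φ` is 1-Lipschitz. -/
theorem radial_integral_le {α ε m a δ R : ℝ} (hα : α ∈ Ico (0 : ℝ) 1) (hε : 0 < ε)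
    (hm : ε * (1 + m ^ 2) ≤ 1 + α - (5 + α) * m ^ 2) (ha : |a| ≤ m) (hδ : 0 < δ) (hδR : δ ≤ R)
    {u u' W W' : ℝ → ℝ} (hu : ∀ r, HasDerivAt u (u' r) r) (hW : ∀ r, HasDerivAt W (W' r) r)
    (hu' : Continuous u') (hW' : Continuous W') (huW : ∀ r, 0 < r → u r ≤ W r)
    (hum : ∀ r, 0 < r → -(m * r) ≤ u r) (hWm : ∀ r, 0 < r → W r ≤ m * r) :
    ∫ r in δ..R, (r * ((a - W' r) * r / (r ^ 2 + W r ^ 2) ^ ((3 + α) / 2))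
        - r * ((a - u' r) * r / (r ^ 2 + u r ^ 2) ^ ((3 + α) / 2))
        + ε / 8 * (r ^ (-1 - α) * (W r / r - u r / r)))
      ≤ δ ^ (-1 - α) * (W δ - u δ) := by
  have hR : 0 < R := hδ.trans_le hδR
  have hpos : ∀ r ∈ uIcc δ R, 0 < r := fun r hr => by
    rw [uIcc_of_le hδR] at hr; exact hδ.trans_le hr.1
  have cq : ∀ {v v' : ℝ → ℝ}, (∀ r, HasDerivAt v (v' r) r) →
      ContinuousOn (fun r => v r / r) (uIcc δ R) := fun hv =>
    ContinuousOn.div (fun r _ => (hv r).continuousAt.continuousWithinAt) continuousOn_id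
      fun r hr => (hpos r hr).ne'
  have cr : ContinuousOn (fun r : ℝ => r ^ (-1 - α)) (uIcc δ R) :=
    continuousOn_id.rpow_const fun r hr => Or.inl (hpos r hr).ne'
  have cE : ∀ {v v' : ℝ → ℝ}, (∀ r, HasDerivAt v (v' r) r) → Continuous v' →
      ContinuousOn (fun r => r ^ (-1 - α) * (α * slopePrimitive α (v r / r)
        + (v r / r - v' r) * slopeWeight α (v r / r))) (uIcc δ R) := fun hv hv' =>
    cr.mul ((continuousOn_const.mul (Continuous.comp_continuousOn
      (continuous_iff_continuousAt.2 fun q => (hasDerivAt_slopePrimitive α q).continuousAt)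
      (cq hv))).add (((cq hv).sub hv'.continuousOn).mul
        ((continuous_slopeWeight α).comp_continuousOn (cq hv))))
  have cF : ∀ {v v' : ℝ → ℝ}, (∀ r, HasDerivAt v (v' r) r) → Continuous v' →
      ContinuousOn (fun r => r * ((a - v' r) * r / (r ^ 2 + v r ^ 2) ^ ((3 + α) / 2)))
        (uIcc δ R) := fun {v v'} hv hv' => by
    have cv : ContinuousOn v (uIcc δ R) := fun r _ => (hv r).continuousAt.continuousWithinAt
    refine continuousOn_id.mul (((continuousOn_const.sub hv'.continuousOn).mul
      continuousOn_id).div (ContinuousOn.rpow_const (by fun_prop) fun r hr => ?_) fun r hr => ?_)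
    · have := hpos r hr
      exact Or.inl (by positivity)
    · have := hpos r hr
      positivity
  have hEint : ∀ {v v' : ℝ → ℝ}, (∀ r, HasDerivAt v (v' r) r) → Continuous v' →
      ∫ r in δ..R, r ^ (-1 - α) * (α * slopePrimitive α (v r / r)
        + (v r / r - v' r) * slopeWeight α (v r / r))
      = radialBoundary α v R - radialBoundary α v δ := fun hv hv' =>
    intervalIntegral.integral_eq_sub_of_hasDerivAt
      (fun r hr => hasDerivAt_radialBoundary (hpos r hr) (hv r)) (cE hv hv').intervalIntegrable
  have hle : ∀ r ∈ Icc δ R, r * ((a - W' r) * r / (r ^ 2 + W r ^ 2) ^ ((3 + α) / 2))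
        - r * ((a - u' r) * r / (r ^ 2 + u r ^ 2) ^ ((3 + α) / 2))
        + ε / 8 * (r ^ (-1 - α) * (W r / r - u r / r))
      ≤ r ^ (-1 - α) * (α * slopePrimitive α (W r / r)
          + (W r / r - W' r) * slopeWeight α (W r / r))
        - r ^ (-1 - α) * (α * slopePrimitive α (u r / r)
          + (u r / r - u' r) * slopeWeight α (u r / r)) := by
    intro r hr
    have hr0 : 0 < r := hδ.trans_le hr.1
    rw [div_rpow_add_sq hr0, div_rpow_add_sq hr0]
    have hk := kernel_decreasing hα hε hm ha (p := u r / r) (q := W r / r)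
      (by rw [le_div_iff₀ hr0]; linarith [hum r hr0]) (by have := huW r hr0; gcongr)
      (by rw [div_le_iff₀ hr0]; exact hWm r hr0)
    have := mul_le_mul_of_nonneg_left hk (Real.rpow_nonneg hr0.le (-1 - α))
    linarith
  have hmono := intervalIntegral.integral_mono_on (μ := volume) hδR
    (((cF hW hW').sub (cF hu hu')).add
      (continuousOn_const.mul (cr.mul ((cq hW).sub (cq hu))))).intervalIntegrable
    ((cE hW hW').sub (cE hu hu')).intervalIntegrable hle
  refine hmono.trans ((intervalIntegral.integral_sub (cE hW hW').intervalIntegrable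
    (cE hu hu').intervalIntegrable).trans_le ?_)
  rw [hEint hW hW', hEint hu hu']
  unfold radialBoundary
  have hRb : 0 ≤ R ^ (-α) * (slopePrimitive α (W R / R) - slopePrimitive α (u R / R)) :=
    mul_nonneg (by positivity) (sub_nonneg.2 (monotone_slopePrimitive α
      (by have := huW R hR; gcongr)))
  have hδb : δ ^ (-α) * (slopePrimitive α (W δ / δ) - slopePrimitive α (u δ / δ))
      ≤ δ ^ (-α) * (W δ / δ - u δ / δ) :=
    mul_le_mul_of_nonneg_left (slopePrimitive_sub_le hα.1 (by have := huW δ hδ; gcongr))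
      (by positivity)
  have e : δ ^ (-α) * (W δ / δ - u δ / δ) = δ ^ (-1 - α) * (W δ - u δ) := by
    rw [show -α = (-1 - α) + 1 by ring, Real.rpow_add_one hδ.ne']
    field_simp
  linarith

/-! ### Integrals over annuli -/

/-- Polar coordinates reduce the integral to rays, so a bound uniform in the direction is multiplied
by the length of the unit circle. -/
theorem setIntegral_annulus_le {F : Plane → ℝ} {δ R c : ℝ} (hδ : 0 < δ) (hδR : δ ≤ R)
    (hF : IntegrableOn F {y | δ < ‖y‖ ∧ ‖y‖ < R} volume)
    (hc : ∀ σ : Plane, ‖σ‖ = 1 → ∫ r in δ..R, r * F (r • σ) ≤ c) :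
    ∫ y in {y : Plane | δ < ‖y‖ ∧ ‖y‖ < R}, F y
      ≤ (volume : Measure Plane).toSphere.real univ * c := by
  set A : Set Plane := {y | δ < ‖y‖ ∧ ‖y‖ < R} with hA
  have hAm : MeasurableSet A :=
    (isOpen_lt continuous_const continuous_norm).inter
      (isOpen_lt continuous_norm continuous_const) |>.measurableSet
  have hdim : Module.finrank ℝ Plane - 1 = 1 := by simp
  have hmp := (volume : Measure Plane).measurePreserving_homeomorphUnitSphereProd
  rw [hdim] at hmp
  set G : Metric.sphere (0 : Plane) 1 × Ioi (0 : ℝ) → ℝ :=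
    fun p => A.indicator F (p.2.1 • p.1.1) with hG
  have hGcomp : ∀ y : ({0}ᶜ : Set Plane), G (homeomorphUnitSphereProd Plane y)
      = A.indicator F y := by
    intro y
    have hy : ‖(y : Plane)‖ ≠ 0 := norm_ne_zero_iff.2 y.2
    simp [hG, smul_smul, hy]
  have hint : Integrable (A.indicator F) := (integrable_indicator_iff hAm).2 hF
  have hGi : Integrable G ((volume : Measure Plane).toSphere.prod (.volumeIoiPow 1)) := by
    rw [← hmp.integrable_comp_emb (Homeomorph.measurableEmbedding _)]
    have : G ∘ (homeomorphUnitSphereProd Plane) = A.indicator F ∘ Subtype.val := funext hGcomp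
    rw [this, ← integrableOn_iff_comap_subtypeVal (by measurability)]
    exact hint.integrableOn
  have e1 : ∫ y in A, F y = ∫ p, G p ∂((volume : Measure Plane).toSphere.prod (.volumeIoiPow 1)) := by
    rw [← hmp.integral_comp (Homeomorph.measurableEmbedding _), ← integral_indicator hAm]
    simp_rw [hGcomp]
    rw [integral_subtype_comap (measurableSet_singleton _).compl (A.indicator F),
      restrict_compl_singleton]
  rw [e1, integral_prod _ hGi]
  have hinner : ∀ σ : Metric.sphere (0 : Plane) 1,
      ∫ r, G (σ, r) ∂(Measure.volumeIoiPow 1) ≤ c := by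
    intro σ
    have hσ : ‖(σ : Plane)‖ = 1 := by simp
    refine le_trans (le_of_eq ?_) (hc σ hσ)
    simp only [Measure.volumeIoiPow, ENNReal.ofReal]
    rw [integral_withDensity_eq_integral_smul
      ((measurable_subtype_coe.pow_const _).real_toNNReal),
      integral_subtype_comap measurableSet_Ioi
        fun a : ℝ => Real.toNNReal (a ^ 1) • A.indicator F (a • (σ : Plane)),
      intervalIntegral.integral_of_le hδR, integral_Ioc_eq_integral_Ioo,
      ← integral_indicator measurableSet_Ioi, ← integral_indicator measurableSet_Ioo]
    congr 1
    ext r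
    by_cases hr : 0 < r
    · have hn : ‖r • (σ : Plane)‖ = r := by rw [norm_smul, hσ, Real.norm_of_nonneg hr.le, mul_one]
      by_cases hr' : r ∈ Ioo δ R
      · have : r • (σ : Plane) ∈ A := by rw [hA]; simpa [hn] using hr'
        simp [hr, hr', this, NNReal.smul_def, hr.le]
      · have : r • (σ : Plane) ∉ A := by rw [hA]; simpa [hn] using hr'
        simp [hr', this]
    · have : r ∉ Ioo δ R := fun h => hr (hδ.trans h.1)
      simp [hr, this]
  calc _ ≤ ∫ σ : Metric.sphere (0 : Plane) 1, c ∂((volume : Measure Plane).toSphere) :=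
        integral_mono hGi.integral_prod_left (integrable_const _) hinner
    _ = _ := by simp

/-! ### The equation at a maximum of a difference -/

theorem norm_gradient_eq (g : Plane → ℝ) (x : Plane) : ‖∇ g x‖ = ‖fderiv ℝ g x‖ := by
  rw [← toDual_gradient, LinearIsometryEquiv.norm_map]

namespace C11Bound

variable {g : Plane → ℝ} {N : ℝ}

theorem nonneg (hg : C11Bound g N) : 0 ≤ N := (abs_nonneg _).trans (hg.abs_le 0)

theorem continuous_fderiv (hg : C11Bound g N) : Continuous (fderiv ℝ g) :=
  (LipschitzWith.of_dist_le_mul (K := ⟨N, hg.nonneg⟩) fun x y => by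
    rw [dist_eq_norm, dist_eq_norm]; exact hg.norm_fderiv_sub_le x y).continuous

theorem continuous_gradient (hg : C11Bound g N) : Continuous (∇ g) :=
  (InnerProductSpace.toDual ℝ Plane).symm.continuous.comp hg.continuous_fderiv

theorem abs_taylor_le (hg : C11Bound g N) (x y : Plane) :
    |g x - g (x - y) - fderiv ℝ g x y| ≤ N * ‖y‖ ^ 2 := by
  have h := (convex_closedBall x ‖y‖).norm_image_sub_le_of_norm_hasFDerivWithin_le'
    (f := g) (f' := fderiv ℝ g) (φ := fderiv ℝ g x) (C := N * ‖y‖) (x := x - y) (y := x)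
    (fun z _ => (hg.differentiable z).hasFDerivAt.hasFDerivWithinAt)
    (fun z hz => (hg.norm_fderiv_sub_le z x).trans (by
      have := mem_closedBall_iff_norm.1 hz
      have := hg.nonneg
      gcongr)) (by simp) (by simp)
  rw [sub_sub_cancel, Real.norm_eq_abs] at h
  exact h.trans_eq (by ring)

end C11Bound

theorem abs_sub_le_of_norm_fderiv_le {g : Plane → ℝ} {m : ℝ} (hd : Differentiable ℝ g)
    (hm : ∀ x, ‖fderiv ℝ g x‖ ≤ m) (x y : Plane) : |g x - g y| ≤ m * ‖x - y‖ :=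
  convex_univ.norm_image_sub_le_of_norm_fderiv_le (fun z _ => hd z) (fun z _ => hm z)
    (mem_univ y) (mem_univ x)

/-- A difference is bounded in `L¹` by the `L¹` norm of the gradient. -/
theorem lintegral_difference_le {g : Plane → ℝ} {N : ℝ} (hg : C11Bound g N) (w : Plane) :
    ∫⁻ z, ‖g (z + w) - g z‖ₑ ≤ ‖w‖ₑ * eLpNorm (∇ g) 1 volume := by
  have hpt : ∀ z, ‖g (z + w) - g z‖ₑ ≤ ∫⁻ s in Ioc (0 : ℝ) 1, ‖∇ g (z + s • w)‖ₑ * ‖w‖ₑ := by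
    intro z
    have hline : ∀ s : ℝ, HasDerivAt (fun s : ℝ => z + s • w) w s := fun s => by
      simpa using ((hasDerivAt_id s).smul_const w).const_add z
    have hder : ∀ s : ℝ, HasDerivAt (fun s : ℝ => g (z + s • w)) (fderiv ℝ g (z + s • w) w) s :=
      fun s => (hg.differentiable _).hasFDerivAt.comp_hasDerivAt s (hline s)
    have hc : Continuous fun s : ℝ => fderiv ℝ g (z + s • w) w :=
      (hg.continuous_fderiv.comp (by fun_prop)).clm_apply continuous_const
    have hint := intervalIntegral.integral_eq_sub_of_hasDerivAt (fun s _ => hder s)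
      (hc.intervalIntegrable 0 1)
    simp only [one_smul, zero_smul, add_zero] at hint
    rw [← hint, intervalIntegral.integral_of_le zero_le_one]
    refine (enorm_integral_le_lintegral_enorm _).trans (lintegral_mono fun s => ?_)
    rw [← inner_gradient_left]
    simp only [enorm_eq_nnnorm]
    exact_mod_cast nnnorm_inner_le_nnnorm (𝕜 := ℝ) (∇ g (z + s • w)) w
  have hcont : Continuous fun p : Plane × ℝ => ‖∇ g (p.1 + p.2 • w)‖ₑ * ‖w‖ₑ := by
    have := (hg.continuous_gradient.comp
      (by fun_prop : Continuous fun p : Plane × ℝ => p.1 + p.2 • w)).enorm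
    exact ENNReal.continuous_mul_const enorm_ne_top |>.comp this
  calc ∫⁻ z, ‖g (z + w) - g z‖ₑ
      ≤ ∫⁻ z, ∫⁻ s in Ioc (0 : ℝ) 1, ‖∇ g (z + s • w)‖ₑ * ‖w‖ₑ := lintegral_mono hpt
    _ = ∫⁻ s in Ioc (0 : ℝ) 1, ∫⁻ z, ‖∇ g (z + s • w)‖ₑ * ‖w‖ₑ :=
        lintegral_lintegral_swap hcont.measurable.aemeasurable
    _ = ∫⁻ s in Ioc (0 : ℝ) 1, ‖w‖ₑ * eLpNorm (∇ g) 1 volume := by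
        refine lintegral_congr fun s => ?_
        rw [lintegral_mul_const' _ _ enorm_ne_top, eLpNorm_one_eq_lintegral_enorm,
          lintegral_add_right_eq_self (fun z => ‖∇ g z‖ₑ), mul_comm]
    _ = _ := by simp

theorem integrable_difference {g : Plane → ℝ} {N M : ℝ} (hg : C11Bound g N) (hM : 0 ≤ M)
    (hL : eLpNorm (∇ g) 1 volume ≤ ENNReal.ofReal M) (w : Plane) :
    Integrable (fun z => g (z + w) - g z) ∧ ∫ z, |g (z + w) - g z| ≤ ‖w‖ * M := by
  have hc : Continuous fun z => g (z + w) - g z :=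
    (hg.differentiable.continuous.comp (by fun_prop)).sub hg.differentiable.continuous
  have hle : ∫⁻ z, ‖g (z + w) - g z‖ₑ ≤ ENNReal.ofReal (‖w‖ * M) := by
    refine (lintegral_difference_le hg w).trans ?_
    rw [ENNReal.ofReal_mul (norm_nonneg w), ofReal_norm]
    gcongr
  refine ⟨⟨hc.aestronglyMeasurable, hle.trans_lt ENNReal.ofReal_lt_top⟩, ?_⟩
  simp_rw [← Real.norm_eq_abs]
  rw [integral_norm_eq_lintegral_enorm hc.aestronglyMeasurable]
  exact ENNReal.toReal_le_of_le_ofReal (by positivity) hle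

theorem measurableSet_annulus (δ R : ℝ) : MeasurableSet {y : Plane | δ < ‖y‖ ∧ ‖y‖ < R} :=
  ((isOpen_lt continuous_const continuous_norm).inter
    (isOpen_lt continuous_norm continuous_const)).measurableSet

theorem volume_real_annulus {δ R : ℝ} (hδ : 0 ≤ δ) (hδR : δ ≤ R) :
    (volume : Measure Plane).real {y : Plane | δ < ‖y‖ ∧ ‖y‖ < R} = Real.pi * (R ^ 2 - δ ^ 2) ∧
    (volume : Measure Plane) {y : Plane | δ < ‖y‖ ∧ ‖y‖ < R} ≠ ∞ := by
  rcases hδR.eq_or_lt with rfl | hlt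
  · have : {y : Plane | δ < ‖y‖ ∧ ‖y‖ < δ} = ∅ := by
      ext y; simp; exact fun h => h.le
    simp [this]
  have e : {y : Plane | δ < ‖y‖ ∧ ‖y‖ < R} = Metric.ball 0 R \ Metric.closedBall 0 δ := by
    ext y
    simp [and_comm]
  have hb : (volume : Measure Plane) (Metric.ball 0 R) ≠ ∞ := measure_ball_lt_top.ne
  refine ⟨?_, ?_⟩
  · rw [e, measureReal_sdiff (Metric.closedBall_subset_ball hlt)
      Metric.isClosed_closedBall.measurableSet, measureReal_def, measureReal_def,
      EuclideanSpace.volume_ball_fin_two, EuclideanSpace.volume_closedBall_fin_two]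
    simp [Real.pi_pos.le, hδ, hδ.trans hδR]
    ring
  · rw [e]
    exact measure_ne_top_of_subset sdiff_subset hb

theorem integrableOn_annulus_rpow_mul {δ R : ℝ} (hδ : 0 < δ) (p : ℝ) {d : Plane → ℝ}
    (hd : Continuous d) :
    IntegrableOn (fun y => ‖y‖ ^ p * d y) {y : Plane | δ < ‖y‖ ∧ ‖y‖ < R} volume := by
  have hK : IsCompact {y : Plane | δ ≤ ‖y‖ ∧ ‖y‖ ≤ R} := by
    refine (isCompact_closedBall (0 : Plane) R).of_isClosed_subset
      ((isClosed_le continuous_const continuous_norm).inter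
        (isClosed_le continuous_norm continuous_const)) fun y hy => by simpa using hy.2
  refine IntegrableOn.mono_set (ContinuousOn.integrableOn_compact hK ?_)
    fun y hy => ⟨hy.1.le, hy.2.le⟩
  exact (continuous_norm.continuousOn.rpow_const fun y hy =>
    Or.inl (hδ.trans_le hy.1).ne').mul hd.continuousOn

/-- Lower bound for the dissipation at a maximum of an integrable function. -/
theorem dissipation_lower_bound {D : Plane → ℝ} (hDc : Continuous D) (hD : Integrable D) {L : ℝ}
    (hL : ∫ z, |D z| ≤ L) {x : Plane} (hmax : ∀ z, D z ≤ D x) {α δ R₀ R : ℝ} (hα : 0 ≤ α)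
    (hδ : 0 < δ) (hδR : δ ≤ R₀) (hR : R₀ ≤ R) :
    R₀ ^ (-3 - α) * (D x * (Real.pi * (R₀ ^ 2 - δ ^ 2)) - L)
      ≤ ∫ y in {y : Plane | δ < ‖y‖ ∧ ‖y‖ < R}, ‖y‖ ^ (-3 - α) * (D x - D (x - y)) := by
  have hR₀ : 0 < R₀ := hδ.trans_le hδR
  set A₀ : Set Plane := {y | δ < ‖y‖ ∧ ‖y‖ < R₀} with hA₀
  have hA₀m : MeasurableSet A₀ := measurableSet_annulus δ R₀
  have hnn : ∀ y, 0 ≤ ‖y‖ ^ (-3 - α) * (D x - D (x - y)) := fun y =>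
    mul_nonneg (by positivity) (sub_nonneg.2 (hmax _))
  have hsc : Continuous fun y => D x - D (x - y) := by fun_prop
  have hDx : Integrable fun y => D (x - y) := hD.comp_sub_left x
  obtain ⟨hvol, hvol'⟩ := volume_real_annulus hδ.le hδR
  have i1 : IntegrableOn (fun _ : Plane => D x) A₀ := integrableOn_const hvol'
  have hI : ∫ y in A₀, D (x - y) ≤ L := by
    calc ∫ y in A₀, D (x - y) ≤ ∫ y in A₀, |D (x - y)| :=
          integral_mono hDx.integrableOn hDx.abs.integrableOn fun y => le_abs_self _
      _ ≤ ∫ y, |D (x - y)| := setIntegral_le_integral hDx.abs (ae_of_all _ fun y => abs_nonneg _)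
      _ = ∫ y, |D y| := integral_sub_left_eq_self (fun y => |D y|) volume x
      _ ≤ L := hL
  calc R₀ ^ (-3 - α) * (D x * (Real.pi * (R₀ ^ 2 - δ ^ 2)) - L)
      ≤ R₀ ^ (-3 - α) * ∫ y in A₀, (D x - D (x - y)) := by
        rw [integral_sub i1 hDx.integrableOn, setIntegral_const, hvol, smul_eq_mul]
        refine mul_le_mul_of_nonneg_left ?_ (by positivity)
        linarith
    _ = ∫ y in A₀, R₀ ^ (-3 - α) * (D x - D (x - y)) := (integral_const_mul _ _).symm
    _ ≤ ∫ y in A₀, ‖y‖ ^ (-3 - α) * (D x - D (x - y)) := by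
        refine setIntegral_mono_on ((i1.sub hDx.integrableOn).const_mul _)
          (integrableOn_annulus_rpow_mul hδ _ hsc) hA₀m fun y hy => ?_
        refine mul_le_mul_of_nonneg_right ?_ (sub_nonneg.2 (hmax _))
        exact Real.rpow_le_rpow_of_nonpos (hδ.trans hy.1) hy.2.le (by linarith)
    _ ≤ _ := setIntegral_mono_set (integrableOn_annulus_rpow_mul hδ _ hsc)
        (ae_of_all _ hnn) (Eventually.of_forall fun y hy => ⟨hy.1, hy.2.trans_le hR⟩)

/-- The truncated difference of the right-hand side of the equation at the two points of a maximal
difference. -/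
theorem truncated_difference_le {α ε m N δ R : ℝ} (hα : α ∈ Ico (0 : ℝ) 1) (hε : 0 < ε)
    (hm : ε * (1 + m ^ 2) ≤ 1 + α - (5 + α) * m ^ 2) {g : Plane → ℝ} (hg : C11Bound g N)
    (hgm : ∀ x, ‖fderiv ℝ g x‖ ≤ m) {w x : Plane} (hmax : ∀ z, g (z + w) - g z ≤ g (x + w) - g x)
    (hδ : 0 < δ) (hδR : δ ≤ R)
    (h₁ : IntegrableOn (contourIntegrand α g (x + w)) {y | δ < ‖y‖ ∧ ‖y‖ < R} volume)
    (h₂ : IntegrableOn (contourIntegrand α g x) {y | δ < ‖y‖ ∧ ‖y‖ < R} volume) :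
    (∫ y in {y : Plane | δ < ‖y‖ ∧ ‖y‖ < R}, contourIntegrand α g (x + w) y)
      - (∫ y in {y : Plane | δ < ‖y‖ ∧ ‖y‖ < R}, contourIntegrand α g x y)
      + ε / 8 * (∫ y in {y : Plane | δ < ‖y‖ ∧ ‖y‖ < R}, ‖y‖ ^ (-3 - α) *
          ((g (x + w) - g x) - (g (x - y + w) - g (x - y))))
      ≤ (volume : Measure Plane).toSphere.real univ * (2 * N * δ ^ (1 - α)) := by
  have hgd := hg.differentiable
  have hgc := hgd.continuous
  -- The first-order condition at the maximum provides the common slope `a` of the two rays.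
  have hgrad : fderiv ℝ g (x + w) = fderiv ℝ g x := by
    have hloc : IsLocalMax (fun z => g (z + w) - g z) x := Eventually.of_forall hmax
    have h := hloc.fderiv_eq_zero
    rw [fderiv_fun_sub (by fun_prop) (hgd x), fderiv_comp_add_right] at h
    exact sub_eq_zero.1 h
  have hi := integrableOn_annulus_rpow_mul (R := R) hδ (-3 - α)
    (d := fun y => (g (x + w) - g x) - (g (x - y + w) - g (x - y))) (by fun_prop)
  have h₁₂ : IntegrableOn (fun y => contourIntegrand α g (x + w) y - contourIntegrand α g x y)
      {y | δ < ‖y‖ ∧ ‖y‖ < R} volume := h₁.sub h₂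
  rw [← integral_const_mul, ← integral_sub h₁ h₂, ← integral_add h₁₂ (hi.const_mul _)]
  refine setIntegral_annulus_le hδ hδR (h₁₂.add (hi.const_mul _)) fun σ hσ => ?_
  have hline : ∀ (z : Plane) (r : ℝ), HasDerivAt (fun r : ℝ => z - r • σ) (-σ) r := fun z r => by
    simpa using ((hasDerivAt_id r).smul_const σ).const_sub z
  have hder : ∀ (z : Plane) (r : ℝ), HasDerivAt (fun r : ℝ => g z - g (z - r • σ))
      (fderiv ℝ g (z - r • σ) σ) r := fun z r => by
    simpa using ((hgd (z - r • σ)).hasFDerivAt.comp_hasDerivAt r (hline z r)).const_sub (g z)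
  have hderc : ∀ z : Plane, Continuous fun r : ℝ => fderiv ℝ g (z - r • σ) σ := fun z =>
    (hg.continuous_fderiv.comp (by fun_prop)).clm_apply continuous_const
  have hslope : ∀ (z : Plane) (r : ℝ), 0 < r → |g z - g (z - r • σ)| ≤ m * r := fun z r hr => by
    have := abs_sub_le_of_norm_fderiv_le hgd hgm z (z - r • σ)
    rwa [sub_sub_cancel, norm_smul, hσ, mul_one, Real.norm_of_nonneg hr.le] at this
  have hrad := radial_integral_le hα hε hm (a := fderiv ℝ g x σ)
    ((((fderiv ℝ g x).le_opNorm σ).trans_eq (by rw [hσ, mul_one])).trans (hgm x)) hδ hδR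
    (hder x) (hder (x + w)) (hderc x) (hderc (x + w))
    (fun r _ => by have := hmax (x - r • σ); rw [sub_add_eq_add_sub] at this; linarith)
    (fun r hr => (abs_le.1 (hslope x r hr)).1) (fun r hr => (abs_le.1 (hslope (x + w) r hr)).2)
  refine le_trans (le_of_eq (intervalIntegral.integral_congr fun r hr => ?_)) (hrad.trans ?_)
  · rw [uIcc_of_le hδR] at hr
    have hr0 : 0 < r := hδ.trans_le hr.1
    have hn : ‖r • σ‖ = r := by rw [norm_smul, hσ, Real.norm_of_nonneg hr0.le, mul_one]
    have hin : ∀ z, inner ℝ (∇ g z - ∇ g (z - r • σ)) (r • σ)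
        = (fderiv ℝ g z σ - fderiv ℝ g (z - r • σ) σ) * r := fun z => by
      rw [inner_sub_left, inner_gradient_left, inner_gradient_left, map_smul, map_smul]
      simp only [smul_eq_mul]
      ring
    have hp : r ^ (-1 - α) = r * r ^ (-3 - α) * r := by
      rw [show -1 - α = (-3 - α) + 1 + 1 by ring, Real.rpow_add_one hr0.ne',
        Real.rpow_add_one hr0.ne']
      ring
    simp only [contourIntegrand, hin, hn, hgrad]
    rw [hp, sub_add_eq_add_sub x (r • σ) w]
    field_simp
    ring
  -- The linear Taylor terms cancel, so the boundary term is `O(δ^{1-α})` and vanishes as `δ → 0`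
  -- because `α < 1`.
  · have t1 := hg.abs_taylor_le (x + w) (δ • σ)
    have t2 := hg.abs_taylor_le x (δ • σ)
    rw [hgrad] at t1
    have hn : ‖δ • σ‖ = δ := by rw [norm_smul, hσ, Real.norm_of_nonneg hδ.le, mul_one]
    rw [hn] at t1 t2
    have hp : δ ^ (1 - α) = δ ^ (-1 - α) * δ ^ 2 := by
      rw [show 1 - α = (-1 - α) + 1 + 1 by ring, Real.rpow_add_one hδ.ne',
        Real.rpow_add_one hδ.ne']
      ring
    rw [hp]
    have := mul_le_mul_of_nonneg_left
      (show (g (x + w) - g (x + w - δ • σ)) - (g x - g (x - δ • σ)) ≤ 2 * N * δ ^ 2 by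
        linarith [(abs_le.1 t1).2, (abs_le.1 t2).1]) (Real.rpow_nonneg hδ.le (-1 - α))
    linarith

/-- At a positive maximum of `g(· + w) - g`, the difference of the velocities is bounded above by a
negative power of the slope. -/
theorem velocity_difference_le {α ε m N M v₁ v₂ : ℝ} (hα : α ∈ Ico (0 : ℝ) 1) (hε : 0 < ε)
    (hm : ε * (1 + m ^ 2) ≤ 1 + α - (5 + α) * m ^ 2) {g : Plane → ℝ} (hg : C11Bound g N)
    (hgm : ∀ x, ‖fderiv ℝ g x‖ ≤ m) (hM : 0 < M) (hL : eLpNorm (∇ g) 1 volume ≤ ENNReal.ofReal M)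
    {w x : Plane} (hw : w ≠ 0) (hmax : ∀ z, g (z + w) - g z ≤ g (x + w) - g x)
    (hpos : 0 < g (x + w) - g x) (h₁ : HasPrincipalValue (contourIntegrand α g (x + w)) v₁)
    (h₂ : HasPrincipalValue (contourIntegrand α g x) v₂) :
    v₁ - v₂ ≤ -(‖w‖ * (ε / 8 * M * (Real.pi / (2 * M)) ^ ((3 + α) / 2))
      * ((g (x + w) - g x) / ‖w‖) ^ ((3 + α) / 2)) := by
  set D := g (x + w) - g x with hD
  have hw0 : 0 < ‖w‖ := norm_pos_iff.2 hw
  set G := D / ‖w‖ with hG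
  have hG0 : 0 < G := div_pos hpos hw0
  have hDG : D = ‖w‖ * G := by rw [hG]; field_simp
  have hπ := Real.pi_pos
  -- Chosen so that `D · πR₀² = 2‖w‖M`: after subtracting the `L¹` mass `‖w‖M`, half of it remains.
  set R₀ := √(2 * M / (Real.pi * G)) with hR₀def
  have hR₀ : 0 < R₀ := by positivity
  have hR₀sq : R₀ ^ 2 = 2 * M / (Real.pi * G) := Real.sq_sqrt (by positivity)
  obtain ⟨hDi, hDL⟩ := integrable_difference hg hM.le hL w
  have hgc := hg.differentiable.continuous
  have hev : ∀ᶠ p : ℝ × ℝ in 𝓝[>] (0 : ℝ) ×ˢ atTop,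
      (∫ y in {y : Plane | p.1 < ‖y‖ ∧ ‖y‖ < p.2}, contourIntegrand α g (x + w) y)
      - (∫ y in {y : Plane | p.1 < ‖y‖ ∧ ‖y‖ < p.2}, contourIntegrand α g x y)
      ≤ (volume : Measure Plane).toSphere.real univ * (2 * N * p.1 ^ (1 - α))
        - ε / 8 * (R₀ ^ (-3 - α) * (D * (Real.pi * (R₀ ^ 2 - p.1 ^ 2)) - ‖w‖ * M)) := by
    have e1 : ∀ᶠ δ in 𝓝[>] (0 : ℝ), δ ∈ Ioo 0 R₀ := Ioo_mem_nhdsGT hR₀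
    filter_upwards [e1.prod_mk (eventually_ge_atTop R₀)] with p hp
    obtain ⟨⟨hδ, hδR⟩, hR⟩ := hp
    have ht := truncated_difference_le hα hε hm hg hgm hmax hδ (hδR.le.trans hR)
      (h₁.1 _ _ hδ) (h₂.1 _ _ hδ)
    have hl := dissipation_lower_bound (D := fun z => g (z + w) - g z) (by fun_prop) hDi hDL
      hmax hα.1 hδ hδR.le hR
    have := mul_le_mul_of_nonneg_left hl (by positivity : 0 ≤ ε / 8)
    linarith
  have hfst : Tendsto (fun p : ℝ × ℝ => p.1) (𝓝[>] (0 : ℝ) ×ˢ atTop) (𝓝 0) :=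
    (tendsto_nhdsWithin_of_tendsto_nhds tendsto_id : Tendsto id (𝓝[>] (0 : ℝ)) (𝓝 0)).comp
      tendsto_fst
  have hpow : Tendsto (fun p : ℝ × ℝ => p.1 ^ (1 - α)) (𝓝[>] (0 : ℝ) ×ˢ atTop) (𝓝 0) := by
    have := hfst.rpow_const (p := 1 - α) (Or.inr (by linarith [hα.2]))
    rwa [Real.zero_rpow (by linarith [hα.2])] at this
  have hlim := ((hpow.const_mul (2 * N)).const_mul ((volume : Measure Plane).toSphere.real univ)).sub
    (((((((hfst.pow 2).const_sub (R₀ ^ 2)).const_mul Real.pi).const_mul D).sub_const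
      (‖w‖ * M)).const_mul (R₀ ^ (-3 - α))).const_mul (ε / 8))
  have hfin := le_of_tendsto_of_tendsto (h₁.2.sub h₂.2) hlim hev
  refine hfin.trans (le_of_eq ?_)
  have hval : D * (Real.pi * (R₀ ^ 2 - 0 ^ 2)) - ‖w‖ * M = ‖w‖ * M := by
    rw [hR₀sq, hDG]
    field_simp
    ring
  have hRp : R₀ ^ (-3 - α) = (Real.pi / (2 * M)) ^ ((3 + α) / 2) * G ^ ((3 + α) / 2) := by
    rw [← Real.mul_rpow (by positivity) hG0.le, hR₀def, Real.sqrt_eq_rpow,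
      ← Real.rpow_mul (by positivity), show 1 / 2 * (-3 - α) = -((3 + α) / 2) by ring,
      Real.rpow_neg (by positivity), ← Real.inv_rpow (by positivity)]
    congr 1
    field_simp
  rw [hval, hRp]
  ring

/-! ### Comparison with the barrier -/

/-- The solution of `B' = -c B^{(3+α)/2}` with `B(0) = L`. -/
noncomputable def decayBarrier (α c L t : ℝ) : ℝ :=
  L / (1 + (1 + α) / 2 * c * L ^ ((1 + α) / 2) * t) ^ (2 / (1 + α))

section Barrier

variable {α c L t : ℝ}

theorem one_le_barrier_base (hα : 0 ≤ α) (hc : 0 ≤ c) (hL : 0 ≤ L) (ht : 0 ≤ t) :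
    1 ≤ 1 + (1 + α) / 2 * c * L ^ ((1 + α) / 2) * t :=
  le_add_of_nonneg_right (by positivity)

theorem decayBarrier_pos (hα : 0 ≤ α) (hc : 0 ≤ c) (hL : 0 < L) (ht : 0 ≤ t) :
    0 < decayBarrier α c L t :=
  div_pos hL (Real.rpow_pos_of_pos
    (zero_lt_one.trans_le (one_le_barrier_base hα hc hL.le ht)) _)

theorem decayBarrier_le (hα : 0 ≤ α) (hc : 0 ≤ c) (hL : 0 ≤ L) (ht : 0 ≤ t) :
    decayBarrier α c L t ≤ L :=
  div_le_self hL (Real.one_le_rpow (one_le_barrier_base hα hc hL ht) (by positivity))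

theorem hasDerivAt_decayBarrier (hα : 0 ≤ α) (hc : 0 ≤ c) (hL : 0 < L) (ht : 0 ≤ t) :
    HasDerivAt (decayBarrier α c L) (-(c * decayBarrier α c L t ^ ((3 + α) / 2))) t := by
  set A := (1 + α) / 2 * c * L ^ ((1 + α) / 2) with hA
  have hb := zero_lt_one.trans_le (one_le_barrier_base hα hc hL.le ht)
  rw [← hA] at hb
  have hlin : HasDerivAt (fun s : ℝ => 1 + A * s) A t := by
    simpa using ((hasDerivAt_id t).const_mul A).const_add 1
  have h := (hlin.rpow_const (p := -(2 / (1 + α))) (Or.inl hb.ne')).const_mul L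
  have hev : decayBarrier α c L =ᶠ[𝓝 t] fun s => L * (1 + A * s) ^ (-(2 / (1 + α))) := by
    have : ∀ᶠ s in 𝓝 t, 0 < 1 + A * s := hlin.continuousAt.eventually (lt_mem_nhds hb)
    filter_upwards [this] with s hs
    rw [decayBarrier, Real.rpow_neg hs.le, div_eq_mul_inv]
  refine (h.congr_of_eventuallyEq hev).congr_deriv ?_
  rw [hev.self_of_nhds, Real.mul_rpow hL.le (by positivity), ← Real.rpow_mul hb.le,
    show -(2 / (1 + α)) * ((3 + α) / 2) = -(2 / (1 + α)) - 1 by field_simp; ring,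
    show (3 + α) / 2 = (1 + α) / 2 + 1 by ring, Real.rpow_add_one hL.ne', hA]
  field_simp

end Barrier

theorem continuousWithinAt_iSup_of_lipschitz {X : Type*} [Nonempty X] {F : ℝ → X → ℝ} {I : Set ℝ}
    {t : ℝ} (ht : t ∈ I) (hb : ∀ s ∈ I, BddAbove (range (F s))) {K : ℝ}
    (hK : ∀ᶠ s in 𝓝[I] t, ∀ x, |F s x - F t x| ≤ K * |s - t|) :
    ContinuousWithinAt (fun s => ⨆ x, F s x) I t := by
  rw [ContinuousWithinAt, tendsto_iff_dist_tendsto_zero]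
  have hlim : Tendsto (fun s => K * |s - t|) (𝓝[I] t) (𝓝 0) := by
    have : Continuous fun s : ℝ => K * |s - t| := by fun_prop
    simpa using (this.tendsto t).mono_left nhdsWithin_le_nhds
  refine squeeze_zero' (Eventually.of_forall fun s => dist_nonneg) ?_ hlim
  filter_upwards [hK, self_mem_nhdsWithin] with s hs hsI
  rw [Real.dist_eq, abs_sub_le_iff]
  constructor
  · rw [sub_le_iff_le_add]
    exact ciSup_le fun x => by linarith [(abs_le.1 (hs x)).2, le_ciSup (hb t ht) x]
  · rw [sub_le_iff_le_add]
    exact ciSup_le fun x => by linarith [(abs_le.1 (hs x)).1, le_ciSup (hb s hsI) x]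

/-- Only slopes from the left are used, so `t` may be the right endpoint of the time interval. -/
theorem nonneg_of_hasDerivWithinAt_of_forall_le {φ : ℝ → ℝ} {φ' t : ℝ} {s : Set ℝ} (ht : 0 < t)
    (hs : Icc 0 t ⊆ s) (hφ : HasDerivWithinAt φ φ' s t) (hmax : ∀ r ∈ Icc 0 t, φ r ≤ φ t) :
    0 ≤ φ' := by
  have hmem : Ioo 0 t ∈ 𝓝[<] t := Ioo_mem_nhdsLT ht
  have h := (hasDerivWithinAt_iff_tendsto_slope' (notMem_Iio.2 le_rfl)).1
    (hφ.mono_of_mem_nhdsWithin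
      (mem_of_superset hmem fun r hr => hs ⟨hr.1.le, hr.2.le⟩) : HasDerivWithinAt φ φ' (Iio t) t)
  refine ge_of_tendsto h ?_
  filter_upwards [hmem] with r hr
  rw [slope_def_field]
  exact div_nonneg_of_nonpos (sub_nonpos.2 (hmax r ⟨hr.1.le, hr.2.le⟩)) (by linarith [hr.2])

/-- The rate of decay of the slope. -/
noncomputable def decayRate (α ε M : ℝ) : ℝ := ε / 8 * M * (Real.pi / (2 * M)) ^ ((3 + α) / 2)

theorem decayRate_pos {α ε M : ℝ} (hε : 0 < ε) (hM : 0 < M) : 0 < decayRate α ε M := by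
  unfold decayRate
  positivity

/-! ### The maximum principle and the continuity argument in time -/

namespace IsSolution

variable {k : ℕ} {α T : ℝ} {f₀ : Plane → ℝ} {f : ℝ → Plane → ℝ}

theorem exists_c11Bound (hf : IsSolution k α T f₀ f) (hk : 4 ≤ k) {t : ℝ} (ht : t ∈ Icc 0 T) :
    ∃ N, C11Bound (f t) N :=
  ⟨_, (hf.isC1Curve.1 t ht).c11Bound hk (hf.continuous t ht)⟩

/-- As long as the slope stays below the threshold, all difference quotients are below the
barrier. -/
theorem difference_le_barrier (hf : IsSolution k α T f₀ f) (hk : 4 ≤ k) {ε M m L τ : ℝ}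
    (hα : α ∈ Ico (0 : ℝ) 1) (hε : 0 < ε) (hM : 0 < M)
    (hm : ε * (1 + m ^ 2) ≤ 1 + α - (5 + α) * m ^ 2) (hτ : τ ∈ Icc 0 T)
    (hslope : ∀ t ∈ Icc 0 τ, ∀ x, ‖fderiv ℝ (f t) x‖ ≤ m)
    (hL1 : ∀ t ∈ Icc 0 T, eLpNorm (∇ (f t)) 1 volume ≤ ENNReal.ofReal M)
    (hL : 0 < L) (h0 : ∀ x, ‖fderiv ℝ (f 0) x‖ ≤ L) {w : Plane} (hw : w ≠ 0)
    {t : ℝ} (ht : t ∈ Icc 0 τ) (x : Plane) :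
    f t (x + w) - f t x ≤ ‖w‖ * decayBarrier α (decayRate α ε M) L t := by
  have hIcc : Icc 0 τ ⊆ Icc 0 T := Icc_subset_Icc_right hτ.2
  have hc := (decayRate_pos (α := α) hε hM)
  have hw0 : 0 < ‖w‖ := norm_pos_iff.2 hw
  set B := decayBarrier α (decayRate α ε M) L with hB
  by_contra! hcon
  set S : ℝ → ℝ := fun s => ⨆ z, (f s (z + w) - f s z) with hS
  have hbdd : ∀ s ∈ Icc 0 T, BddAbove (range fun z => f s (z + w) - f s z) := by
    intro s hs
    obtain ⟨N, hN⟩ := hf.exists_c11Bound hk hs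
    refine ⟨N + N, ?_⟩
    rintro _ ⟨z, rfl⟩
    linarith [(abs_le.1 (hN.abs_le (z + w))).2, (abs_le.1 (hN.abs_le z)).1]
  have hScont : ContinuousOn S (Icc 0 T) := by
    intro s hs
    obtain ⟨K, -, hK⟩ := hf.isC1Curve.exists_lipschitz_bound hk hf.continuous hs
    refine continuousWithinAt_iSup_of_lipschitz (K := 2 * K) hs hbdd ?_
    filter_upwards [hK] with r hr z
    have h1 := abs_le.1 (hr (z + w)).1
    have h2 := abs_le.1 (hr z).1
    rw [abs_le]
    constructor <;> linarith [h1.1, h1.2, h2.1, h2.2]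
  have hBder : ∀ s ∈ Icc 0 τ, HasDerivAt B (-(decayRate α ε M * B s ^ ((3 + α) / 2))) s :=
    fun s hs => hasDerivAt_decayBarrier hα.1 hc.le hL hs.1
  have hcont : ContinuousOn (fun s => S s - ‖w‖ * B s) (Icc 0 τ) :=
    (hScont.mono hIcc).sub (continuousOn_const.mul
      fun s hs => (hBder s hs).continuousAt.continuousWithinAt)
  -- At the time of the largest excess over the barrier, the derivative of the excess at a fixed
  -- maximum point is nonnegative; this avoids differentiating the supremum.
  obtain ⟨t₁, ht₁, hmax⟩ := isCompact_Icc.exists_isMaxOn ⟨t, ht⟩ hcont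
  have hgap : 0 < S t₁ - ‖w‖ * B t₁ := by
    have h1 : S t - ‖w‖ * B t ≤ S t₁ - ‖w‖ * B t₁ := hmax ht
    have h2 : f t (x + w) - f t x ≤ S t := le_ciSup (hbdd t (hIcc ht)) x
    linarith
  have hBpos : 0 < B t₁ := decayBarrier_pos hα.1 hc.le hL ht₁.1
  have hSpos : 0 < S t₁ := by nlinarith
  have ht₁T := hIcc ht₁
  obtain ⟨N, hN⟩ := hf.exists_c11Bound hk ht₁T
  obtain ⟨x₀, hx₀⟩ := exists_lt_of_lt_ciSup hSpos
  have hlim : Tendsto (fun z => f t₁ (z + w) - f t₁ z) (cocompact Plane) (𝓝 0) := by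
    simpa using (hN.tendsto_zero.comp (Homeomorph.addRight w).isClosedEmbedding.tendsto_cocompact).sub
      hN.tendsto_zero
  have hdc : Continuous fun z => f t₁ (z + w) - f t₁ z := by
    have := hN.differentiable.continuous
    fun_prop
  -- The supremum is attained, since the difference is positive somewhere and tends to zero at
  -- infinity.
  obtain ⟨x₁, hx₁⟩ := hdc.exists_forall_ge' x₀ ((hlim.eventually (gt_mem_nhds hx₀)).mono
    fun _ h => h.le)
  have hSx₁ : S t₁ = f t₁ (x₁ + w) - f t₁ x₁ :=
    le_antisymm (ciSup_le hx₁) (le_ciSup (hbdd t₁ ht₁T) x₁)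
  have ht₁pos : 0 < t₁ := by
    refine lt_of_le_of_ne ht₁.1 fun h => ?_
    rw [← h] at hgap hN
    have : S 0 ≤ ‖w‖ * L := ciSup_le fun z => by
      have := abs_sub_le_of_norm_fderiv_le hN.differentiable h0 (z + w) z
      rw [add_sub_cancel_left, mul_comm] at this
      exact (le_abs_self _).trans this
    have hB0 : B 0 = L := by simp [hB, decayBarrier]
    rw [hB0] at hgap
    linarith
  obtain ⟨v₁, hpv₁, hd₁⟩ := hf.equation t₁ ht₁T (x₁ + w)
  obtain ⟨v₂, hpv₂, hd₂⟩ := hf.equation t₁ ht₁T x₁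
  have hder := (hd₁.sub hd₂).sub ((hBder t₁ ht₁).hasDerivWithinAt.const_mul ‖w‖)
  have hnn := nonneg_of_hasDerivWithinAt_of_forall_le ht₁pos (Icc_subset_Icc_right ht₁T.2) hder
    fun r hr => by
      have hrτ : r ∈ Icc 0 τ := ⟨hr.1, hr.2.trans ht₁.2⟩
      have h1 : S r - ‖w‖ * B r ≤ S t₁ - ‖w‖ * B t₁ := hmax hrτ
      have h2 : f r (x₁ + w) - f r x₁ ≤ S r := le_ciSup (hbdd r (hIcc hrτ)) x₁
      simp only [Pi.sub_apply]
      linarith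
  have hv := velocity_difference_le hα hε hm hN (hslope t₁ ht₁) hM (hL1 t₁ ht₁T) hw hx₁
    (hSx₁ ▸ hSpos) hpv₁ hpv₂
  have hlt : B t₁ < (f t₁ (x₁ + w) - f t₁ x₁) / ‖w‖ := by
    rw [lt_div_iff₀ hw0, ← hSx₁]
    linarith
  -- Above the barrier the difference decays strictly faster than `‖w‖ B`, contradicting `hnn`.
  have hpow := Real.rpow_lt_rpow hBpos.le hlt (by linarith [hα.1] : 0 < (3 + α) / 2)
  have := mul_lt_mul_of_pos_left hpow (mul_pos hw0 hc)
  unfold decayRate at this hnn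
  linarith

theorem norm_fderiv_le_barrier (hf : IsSolution k α T f₀ f) (hk : 4 ≤ k) {ε M m L τ : ℝ}
    (hα : α ∈ Ico (0 : ℝ) 1) (hε : 0 < ε) (hM : 0 < M)
    (hm : ε * (1 + m ^ 2) ≤ 1 + α - (5 + α) * m ^ 2) (hτ : τ ∈ Icc 0 T)
    (hslope : ∀ t ∈ Icc 0 τ, ∀ x, ‖fderiv ℝ (f t) x‖ ≤ m)
    (hL1 : ∀ t ∈ Icc 0 T, eLpNorm (∇ (f t)) 1 volume ≤ ENNReal.ofReal M)
    (hL : 0 < L) (h0 : ∀ x, ‖fderiv ℝ (f 0) x‖ ≤ L) {t : ℝ} (ht : t ∈ Icc 0 τ) (x : Plane) :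
    ‖fderiv ℝ (f t) x‖ ≤ decayBarrier α (decayRate α ε M) L t := by
  have key := fun {w : Plane} (hw : w ≠ 0) =>
    hf.difference_le_barrier hk hα hε hM hm hτ hslope hL1 hL h0 hw ht
  refine norm_fderiv_le_of_lip' ℝ
    (decayBarrier_pos hα.1 (decayRate_pos hε hM).le hL ht.1).le (Eventually.of_forall fun y => ?_)
  rcases eq_or_ne y x with rfl | hyx
  · simp
  have h1 := key (sub_ne_zero.2 hyx) x
  have h2 := key (sub_ne_zero.2 hyx.symm) y
  rw [add_sub_cancel, mul_comm] at h1 h2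
  rw [norm_sub_rev x y] at h2
  rw [Real.norm_eq_abs, abs_le]
  constructor <;> linarith

/-- The slope stays below the threshold. -/
theorem norm_fderiv_le_threshold (hf : IsSolution k α T f₀ f) (hk : 4 ≤ k) {ε M m L : ℝ}
    (hα : α ∈ Ico (0 : ℝ) 1) (hε : 0 < ε) (hM : 0 < M)
    (hm : ε * (1 + m ^ 2) ≤ 1 + α - (5 + α) * m ^ 2)
    (hL1 : ∀ t ∈ Icc 0 T, eLpNorm (∇ (f t)) 1 volume ≤ ENNReal.ofReal M)
    (hL : 0 < L) (hLm : L < m) (h0 : ∀ x, ‖fderiv ℝ (f 0) x‖ ≤ L) {t : ℝ} (ht : t ∈ Icc 0 T)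
    (x : Plane) : ‖fderiv ℝ (f t) x‖ ≤ m := by
  by_contra! hcon
  set S : ℝ → ℝ := fun s => ⨆ z, ‖fderiv ℝ (f s) z‖ with hS
  have hbdd : ∀ s ∈ Icc 0 T, BddAbove (range fun z => ‖fderiv ℝ (f s) z‖) := by
    intro s hs
    obtain ⟨N, hN⟩ := hf.exists_c11Bound hk hs
    exact ⟨N, by rintro _ ⟨z, rfl⟩; exact hN.norm_fderiv_le z⟩
  have hScont : ContinuousOn S (Icc 0 T) := by
    intro s hs
    obtain ⟨K, -, hK⟩ := hf.isC1Curve.exists_lipschitz_bound hk hf.continuous hs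
    refine continuousWithinAt_iSup_of_lipschitz (K := K) hs hbdd ?_
    filter_upwards [hK] with r hr z
    exact (abs_norm_sub_norm_le _ _).trans (hr z).2
  -- Take the first time at which the slope reaches `m`. Before it the barrier applies and gives
  -- slope at most `L < m`, which persists at that time by continuity.
  have hZ : IsCompact (Icc 0 T ∩ S ⁻¹' Ici m) :=
    isCompact_Icc.of_isClosed_subset (hScont.preimage_isClosed_of_isClosed isClosed_Icc isClosed_Ici)
      inter_subset_left
  obtain ⟨t₁, ⟨ht₁, ht₁m⟩, hleast⟩ := hZ.exists_isLeast
    ⟨t, ht, hcon.le.trans (le_ciSup (hbdd t ht) x)⟩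
  have hbefore : ∀ s ∈ Ico 0 t₁, S s ≤ L := by
    intro s hs
    have hsT : s ∈ Icc 0 T := ⟨hs.1, hs.2.le.trans ht₁.2⟩
    refine ciSup_le fun z => (hf.norm_fderiv_le_barrier hk hα hε hM hm hsT ?_ hL1 hL h0
      ⟨hs.1, le_rfl⟩ z).trans (decayBarrier_le hα.1 (decayRate_pos hε hM).le hL.le hs.1)
    intro r hr y
    have hrT : r ∈ Icc 0 T := ⟨hr.1, hr.2.trans hsT.2⟩
    refine (le_ciSup (hbdd r hrT) y).trans (le_of_lt ?_)
    by_contra! h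
    exact absurd (hleast ⟨hrT, h⟩) (not_le.2 (hr.2.trans_lt hs.2))
  have hSt₁ : S t₁ ≤ L := by
    rcases ht₁.1.eq_or_lt with h | h
    · rw [← h]
      exact ciSup_le h0
    · have hmem : Ioo 0 t₁ ∈ 𝓝[<] t₁ := Ioo_mem_nhdsLT h
      have hlim : Tendsto S (𝓝[<] t₁) (𝓝 (S t₁)) :=
        (hScont t₁ ht₁).mono_of_mem_nhdsWithin
          (mem_of_superset hmem fun r hr => ⟨hr.1.le, hr.2.le.trans ht₁.2⟩)
      refine le_of_tendsto hlim ?_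
      filter_upwards [hmem] with r hr
      exact hbefore r ⟨hr.1.le, hr.2⟩
  exact absurd (hSt₁.trans_lt hLm) (not_lt.2 ht₁m)

/-- Decay of the slope below the threshold. -/
theorem norm_fderiv_le_decayBarrier (hf : IsSolution k α T f₀ f) (hk : 4 ≤ k) {ε M m L : ℝ}
    (hα : α ∈ Ico (0 : ℝ) 1) (hε : 0 < ε) (hM : 0 < M)
    (hm : ε * (1 + m ^ 2) ≤ 1 + α - (5 + α) * m ^ 2)
    (hL1 : ∀ t ∈ Icc 0 T, eLpNorm (∇ (f t)) 1 volume ≤ ENNReal.ofReal M)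
    (hL : 0 < L) (hLm : L < m) (h0 : ∀ x, ‖fderiv ℝ (f 0) x‖ ≤ L) {t : ℝ} (ht : t ∈ Icc 0 T)
    (x : Plane) : ‖fderiv ℝ (f t) x‖ ≤ decayBarrier α (decayRate α ε M) L t :=
  hf.norm_fderiv_le_barrier hk hα hε hM hm (right_mem_Icc.2 (ht.1.trans ht.2))
    (fun _ hs => hf.norm_fderiv_le_threshold hk hα hε hM hm hL1 hL hLm h0 hs) hL1 hL h0 ht x

end IsSolution

/-! ### Essential suprema, the constant and the conclusion -/

/-- The essential bound holds on a dense set, and the gradient is continuous. -/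
theorem C11Bound.norm_fderiv_le_eLpNorm {g : Plane → ℝ} {N : ℝ} (hg : C11Bound g N) (x : Plane) :
    ‖fderiv ℝ g x‖ ≤ (eLpNorm (∇ g) ∞ volume).toReal := by
  have hfin : eLpNorm (∇ g) ∞ volume ≠ ∞ := by
    rw [eLpNorm_exponent_top]
    exact ((eLpNormEssSup_le_of_ae_bound (C := N) (ae_of_all _ fun z =>
      norm_gradient_eq g z ▸ hg.norm_fderiv_le z)).trans_lt ENNReal.ofReal_lt_top).ne
  have hae : ∀ᵐ z ∂(volume : Measure Plane), ‖∇ g z‖ ≤ (eLpNorm (∇ g) ∞ volume).toReal := by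
    filter_upwards [ae_le_eLpNormEssSup (f := ∇ g) (μ := volume)] with z hz
    rw [← eLpNorm_exponent_top] at hz
    have := ENNReal.toReal_mono hfin hz
    rwa [toReal_enorm] at this
  have hcl : IsClosed {z | ‖∇ g z‖ ≤ (eLpNorm (∇ g) ∞ volume).toReal} :=
    isClosed_le hg.continuous_gradient.norm continuous_const
  have hx := (Measure.dense_of_ae hae).closure_eq ▸ mem_univ x
  rw [hcl.closure_eq] at hx
  rw [← norm_gradient_eq]
  exact hx

open Classical in
/-- The constant of the decay estimate. -/
noncomputable def decayConst (_a b M ε α : ℝ) : ℝ :=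
  if 0 ≤ α ∧ 0 < b ∧ 0 < M ∧ 0 < ε then
    (1 + α) / 2 * decayRate α ε M * b ^ ((1 + α) / 2)
  -- For `b = 0` the formula would vanish; the value `1` keeps the constant positive, and the
  -- estimate then says that the gradient stays zero.
  else 1

theorem decayConst_pos (a b M ε α : ℝ) : 0 < decayConst a b M ε α := by
  unfold decayConst
  split_ifs with h
  · obtain ⟨hα, hb, hM, hε⟩ := h
    have := decayRate_pos (α := α) hε hM
    positivity
  · exact zero_lt_one

end AlphaMuskat

theorem mainTheorem6 :
    ∃ C : ℝ → ℝ → ℝ → ℝ → ℝ → ℝ,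
      (∀ a b M ε α : ℝ, 0 < C a b M ε α) ∧
      ∀ (k : ℕ) (α ε T M : ℝ) (f₀ : AlphaMuskat.Plane → ℝ) (f : ℝ → AlphaMuskat.Plane → ℝ),
        4 ≤ k → α ∈ Ico (0 : ℝ) 1 → ε ∈ Ioo 0 (1 + α) → 0 < T → 0 < M →
        AlphaMuskat.MemH k f₀ →
        AlphaMuskat.IsSolution k α T f₀ f →
        eLpNorm (∇ f₀) ∞ volume
          < ENNReal.ofReal (Real.sqrt ((1 + α - ε) / (5 + α + ε))) →
        (∀ t ∈ Icc 0 T, eLpNorm (∇ (f t)) 1 volume ≤ ENNReal.ofReal M) →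
        ∀ t ∈ Icc 0 T,
          eLpNorm (∇ (f t)) ∞ volume ≤
            eLpNorm (∇ f₀) ∞ volume /
              ENNReal.ofReal
                ((1 + C (eLpNorm f₀ ∞ volume).toReal (eLpNorm (∇ f₀) ∞ volume).toReal M ε α * t)
                  ^ (2 / (1 + α))) := by
  refine ⟨AlphaMuskat.decayConst, AlphaMuskat.decayConst_pos, ?_⟩
  intro k α ε T M f₀ f hk hα hε hT hM _ hf hsmall hL1 t ht
  have h0T : (0 : ℝ) ∈ Icc 0 T := left_mem_Icc.2 hT.le
  obtain ⟨N, hN⟩ := hf.exists_c11Bound hk h0T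
  have hinit := hN.norm_fderiv_le_eLpNorm
  rw [hf.initial] at hinit
  set b := (eLpNorm (∇ f₀) ∞ volume).toReal with hb
  set a := (eLpNorm f₀ ∞ volume).toReal
  have hbtop : eLpNorm (∇ f₀) ∞ volume ≠ ∞ := (hsmall.trans ENNReal.ofReal_lt_top).ne
  have hbe : eLpNorm (∇ f₀) ∞ volume = ENNReal.ofReal b := (ENNReal.ofReal_toReal hbtop).symm
  set m := √((1 + α - ε) / (5 + α + ε)) with hmdef
  have hden : 0 < 5 + α + ε := by linarith [hα.1, hε.1]
  have hm2 : m ^ 2 = (1 + α - ε) / (5 + α + ε) :=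
    Real.sq_sqrt (div_nonneg (by linarith [hε.2]) hden.le)
  -- The smallness threshold is exactly the value of `m` giving equality here.
  have hm : ε * (1 + m ^ 2) ≤ 1 + α - (5 + α) * m ^ 2 := by
    rw [hm2]
    refine le_of_eq ?_
    field_simp
    ring
  have hb0 : 0 ≤ b := ENNReal.toReal_nonneg
  have hbm : b < m := by
    rw [hbe] at hsmall
    exact (ENNReal.ofReal_lt_ofReal_iff_of_nonneg hb0).1 hsmall
  have hdecay := fun {L : ℝ} (hL : 0 < L) (hbL : b ≤ L) (hLm : L < m) =>
    hf.norm_fderiv_le_decayBarrier hk hα hε.1 hM hm hL1 hL hLm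
      (fun x => hf.initial ▸ (hinit x).trans hbL) ht
  have hbound : ∀ x, ‖∇ (f t) x‖
      ≤ b / (1 + AlphaMuskat.decayConst a b M ε α * t) ^ (2 / (1 + α)) := by
    intro x
    rw [AlphaMuskat.norm_gradient_eq]
    rcases hb0.eq_or_lt with hb00 | hbpos
    · rw [← hb00, zero_div]
      -- The barrier needs a positive initial value, so a flat datum is treated with arbitrarily
      -- small `L`.
      refine le_of_forall_gt_imp_ge_of_dense fun L hL => ?_
      have hL' : 0 < min L (m / 2) := lt_min hL (by linarith)
      refine (hdecay hL' (hb00 ▸ hL'.le) ((min_le_right _ _).trans_lt (by linarith)) x).trans ?_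
      exact (AlphaMuskat.decayBarrier_le hα.1 (AlphaMuskat.decayRate_pos hε.1 hM).le hL'.le
        ht.1).trans (min_le_left _ _)
    · have hC : AlphaMuskat.decayConst a b M ε α
          = (1 + α) / 2 * AlphaMuskat.decayRate α ε M * b ^ ((1 + α) / 2) :=
        if_pos ⟨hα.1, hbpos, hM, hε.1⟩
      rw [hC]
      exact hdecay hbpos le_rfl hbm x
  have hbase : 0 < (1 + AlphaMuskat.decayConst a b M ε α * t) ^ (2 / (1 + α)) := by
    have := mul_nonneg (AlphaMuskat.decayConst_pos a b M ε α).le ht.1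
    exact Real.rpow_pos_of_pos (by linarith) _
  rw [hbe, ← ENNReal.ofReal_div_of_pos hbase, eLpNorm_exponent_top]
  exact eLpNormEssSup_le_of_ae_bound (ae_of_all _ hbound)
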